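/- Definitions. A symmetric association scheme with $n$ classes is a finite set $X$ with nonempty symmetric relations $R_0,\dots,R_n$ partitioning $X\times X$, where $R_0$ is the diagonal, such that for all $i,j,k$ and $(x,y)\in R_k$ the number $|\{z: (x,z)\in R_i,(z,y)\in R_j\}|$ depends only on $i,j,k$. Let $E_0=|X|^{-1}J,E_1,\dots,E_n$ be an ordering of the primitive idempotents of the span of the adjacency matrices, and define the Krein numbers by $E_i\circ E_j=|X|^{-1}\sum_k q_{ij}^kE_k$ ($\circ$ the entrywise product); put $a_j^*=q_{1,j}^j$, $b_j^*=q_{1,j+1}^j$, $c_j^*=q_{1,j-1}^j$, $b_n^*=c_0^*=0$. With respect to this ordering the scheme is $Q$-polynomial if $q_{1j}^k=0$ for $|j-k|>1$ and $q_{1j}^k\ne0$ for $|j-k|=1$; it is then $Q$-bipartite if $a_j^*=0$ for all $j$, and $Q$-antipodal if $b_j^*=c_{n-j}^*$ for all $j\neq\lfloor n/2\rfloor$. The $Q$-antipodal classes are the classes of the relation $(E_0+E_n)(x,y)\ne0$. The scheme is quadruply regular if for all $i_1,\dots,i_4$ and all $x_1,\dots,x_4\in X$ the number $|\{w\in X: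 (x_k,w)\in R_{i_k},\ k=1,\dots,4\}|$ depends only on $i_1,\dots,i_4$ and on the relations $R_{j_{kl}}\ni(x_k,x_l)$, $1\le k<l\le4$. Real mutually unbiased bases (MUB) in $\mathbb R^d$ are orthonormal bases $M_1,\dots,M_f$ of $\mathbb R^d$ such that $\langle x,y\rangle=\pm1/\sqrt d$ for $x,y$ from different bases; write $M=\bigcup_i M_i$. The MUB is called maximal if $f=d/2+1$ (the general upper bound for $f$). Theorem. (1) Let $(X,\{R_i\}_{i=0}^4)$ be a $4$-class symmetric association scheme that is $Q$-polynomial, $Q$-antipodal and $Q$-bipartite with respect to an ordering $E_0,\dots,E_4$, let $d=\operatorname{rank}E_1$, and let $f$ be the number of $Q$-antipodal classes. Then the scheme is quadruply regular if and only if $f=\frac d2+1$. Moreover every $Q$-antipodal class has size $2d$, and there are real MUB $M_1,\dots,M_f$ in $\mathbb R^d$ and a bijection $\varphi:X\to M\cup(-M)$ with $\langle\varphi(x),\varphi(y)\rangle=\frac{|X|}{d}E_1(x,y)$ for all $x,y\in X$ which, up to a permutation of the relations, carries $R_0,\dots,R_4$ to the relations $\langle x,y\rangle=1,\frac1{\sqrt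 d},0,-\frac1{\sqrt d},-1$. (2) Conversely, let $M_1,\dots,M_f$ be real MUB in $\mathbb R^d$ with $d,f\ge2$. Then $M\cup(-M)$ with the relations $\langle x,y\rangle=1,\frac1{\sqrt d},0,-\frac1{\sqrt d},-1$ is a $4$-class symmetric association scheme that is $Q$-polynomial, $Q$-antipodal and $Q$-bipartite with respect to some ordering of its primitive idempotents with $\operatorname{rank}E_1=d$ and with $f$ $Q$-antipodal classes, and it is quadruply regular if and only if $f=\frac d2+1$, that is, if and only if the MUB is maximal. -/

import Mathlib

open scoped Matrix

noncomputable section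

/-- The relations `R 0, …, R n` on the finite set `X` form a symmetric association scheme
with `n` classes. -/
structure IsSymmetricAssociationScheme {X : Type*} [Fintype X] {n : ℕ}
    (R : Fin (n + 1) → X → X → Prop) : Prop where
  rel_nonempty : ∀ i, ∃ x y, R i x y
  rel_partition : ∀ x y, ∃! i, R i x y
  rel_zero_iff : ∀ x y, R 0 x y ↔ x = y
  rel_symm : ∀ i x y, R i x y → R i y x
  intersection_number : ∀ i j k, ∃ p : ℕ, ∀ x y, R k x y →
    {z | R i x z ∧ R j z y}.ncard = p

open Classical in
/-- The adjacency matrix of the `i`-th relation. -/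
def adjacency {X : Type*} {n : ℕ} (R : Fin (n + 1) → X → X → Prop) (i : Fin (n + 1)) :
    Matrix X X ℝ :=
  Matrix.of fun x y => if R i x y then 1 else 0

/-- The Bose-Mesner algebra (as a space of matrices): the span of the adjacency matrices. -/
def boseMesner {X : Type*} {n : ℕ} (R : Fin (n + 1) → X → X → Prop) :
    Submodule ℝ (Matrix X X ℝ) :=
  Submodule.span ℝ (Set.range (adjacency R))

/-- `E 0, …, E n` is an ordering of the primitive idempotents of the Bose-Mesner algebra, with
`E 0 = |X|⁻¹ J`.  The algebra of an `n`-class scheme is commutative of dimension `n + 1`, so a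
decomposition of `1` into `n + 1` nonzero mutually orthogonal idempotents of the algebra
consists exactly of its primitive idempotents. -/
structure IsPrimitiveIdempotentOrdering {X : Type*} [Fintype X] [DecidableEq X] {n : ℕ}
    (R : Fin (n + 1) → X → X → Prop) (E : Fin (n + 1) → Matrix X X ℝ) : Prop where
  mem_boseMesner : ∀ i, E i ∈ boseMesner R
  zero_eq : E 0 = Matrix.of fun _ _ => (Fintype.card X : ℝ)⁻¹
  idem : ∀ i, E i * E i = E i
  orth : ∀ i j, i ≠ j → E i * E j = 0
  sum_eq_one : ∑ i, E i = 1
  ne_zero : ∀ i, E i ≠ 0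

/-- The Krein number `q_{ij}^k`, that is, the coefficient in
`E i ∘ E j = |X|⁻¹ ∑ k, q_{ij}^k E k` (entrywise product), extracted by
multiplying with `E k` and taking the trace; see `hadamard_eq_sum_kreinNumber`. -/
def kreinNumber {X : Type*} [Fintype X] {n : ℕ} (E : Fin (n + 1) → Matrix X X ℝ)
    (i j k : Fin (n + 1)) : ℝ :=
  Fintype.card X * ((E i ⊙ E j) * E k).trace / (E k).trace

/-- The scheme is `Q`-polynomial with respect to the ordering `E`: the matrix of Krein numbers
`q_{1j}^k` is irreducible tridiagonal. -/
def IsQPolynomial {X : Type*} [Fintype X] {n : ℕ} (E : Fin (n + 1) → Matrix X X ℝ) : Prop :=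
  ∀ j k : Fin (n + 1),
    ((j : ℕ) + 1 < k ∨ (k : ℕ) + 1 < j → kreinNumber E 1 j k = 0) ∧
    ((j : ℕ) + 1 = k ∨ (k : ℕ) + 1 = j → kreinNumber E 1 j k ≠ 0)

/-- `a_j^* = q_{1,j}^j`. -/
def kreinA {X : Type*} [Fintype X] {n : ℕ} (E : Fin (n + 1) → Matrix X X ℝ)
    (j : Fin (n + 1)) : ℝ :=
  kreinNumber E 1 j j

/-- `b_j^* = q_{1,j+1}^j` for `j < n`, and `b_n^* = 0`. -/
def kreinB {X : Type*} [Fintype X] {n : ℕ} (E : Fin (n + 1) → Matrix X X ℝ)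
    (j : Fin (n + 1)) : ℝ :=
  if h : (j : ℕ) < n then kreinNumber E 1 ⟨j + 1, by omega⟩ j else 0

/-- `c_j^* = q_{1,j-1}^j` for `j > 0`, and `c_0^* = 0`. -/
def kreinC {X : Type*} [Fintype X] {n : ℕ} (E : Fin (n + 1) → Matrix X X ℝ)
    (j : Fin (n + 1)) : ℝ :=
  if 0 < (j : ℕ) then kreinNumber E 1 ⟨j - 1, by omega⟩ j else 0

/-- `Q`-bipartite: `a_j^* = 0` for all `j`. -/
def IsQBipartite {X : Type*} [Fintype X] {n : ℕ} (E : Fin (n + 1) → Matrix X X ℝ) : Prop :=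
  ∀ j, kreinA E j = 0

/-- `Q`-antipodal: `b_j^* = c_{n-j}^*` for all `j`, except possibly `j = ⌊n/2⌋`. -/
def IsQAntipodal {X : Type*} [Fintype X] {n : ℕ} (E : Fin (n + 1) → Matrix X X ℝ) : Prop :=
  ∀ j : Fin (n + 1), (j : ℕ) ≠ n / 2 → kreinB E j = kreinC E j.rev

/-- The `Q`-antipodal class of `x`: the class of `x` under the equivalence relation whose
adjacency matrix is a multiple of `E 0 + E n`. -/
def qAntipodalClass {X : Type*} {n : ℕ} (E : Fin (n + 1) → Matrix X X ℝ) (x : X) : Set X :=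
  {y | (E 0 + E (Fin.last n)) x y ≠ 0}

/-- The number of `Q`-antipodal classes. -/
def numQAntipodalClasses {X : Type*} {n : ℕ} (E : Fin (n + 1) → Matrix X X ℝ) : ℕ :=
  (Set.range (qAntipodalClass E)).ncard

/-- Quadruple regularity. -/
def IsQuadruplyRegular {X : Type*} {n : ℕ} (R : Fin (n + 1) → X → X → Prop) : Prop :=
  ∀ (i : Fin 4 → Fin (n + 1)) (j : Fin 4 → Fin 4 → Fin (n + 1)), ∃ c : ℕ,
    ∀ x : Fin 4 → X, (∀ k l, k < l → R (j k l) (x k) (x l)) →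
      {w | ∀ k, R (i k) (x k) w}.ncard = c

/-- A family of `f` orthonormal bases of `ℝ^d` is mutually unbiased. -/
def IsMUB {d f : ℕ}
    (M : Fin f → OrthonormalBasis (Fin d) ℝ (EuclideanSpace ℝ (Fin d))) : Prop :=
  ∀ a b, a ≠ b → ∀ i j, inner ℝ (M a i) (M b j) = 1 / √(d : ℝ) ∨
    inner ℝ (M a i) (M b j) = -(1 / √(d : ℝ))

/-- The set `M ∪ (-M)`. -/
def mubPoints {d f : ℕ}
    (M : Fin f → OrthonormalBasis (Fin d) ℝ (EuclideanSpace ℝ (Fin d))) :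
    Set (EuclideanSpace ℝ (Fin d)) :=
  {v | ∃ a i, v = M a i ∨ v = -M a i}

theorem mubPoints_finite {d f : ℕ}
    (M : Fin f → OrthonormalBasis (Fin d) ℝ (EuclideanSpace ℝ (Fin d))) :
    (mubPoints M).Finite := by
  refine ((Set.finite_range fun p : Fin f × Fin d => M p.1 p.2).union
    (Set.finite_range fun p : Fin f × Fin d => -M p.1 p.2)).subset ?_
  rintro v ⟨a, i, h | h⟩
  · exact Or.inl ⟨(a, i), h.symm⟩
  · exact Or.inr ⟨(a, i), h.symm⟩

instance mubPointsFintype {d f : ℕ}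
    (M : Fin f → OrthonormalBasis (Fin d) ℝ (EuclideanSpace ℝ (Fin d))) :
    Fintype (mubPoints M) :=
  (mubPoints_finite M).fintype

instance mubPointsDecidableEq {d f : ℕ}
    (M : Fin f → OrthonormalBasis (Fin d) ℝ (EuclideanSpace ℝ (Fin d))) :
    DecidableEq (mubPoints M) :=
  Classical.decEq _

/-- The angles `1, 1/√d, 0, -1/√d, -1`. -/
def mubAngle (d : ℕ) : Fin 5 → ℝ :=
  ![1, 1 / √(d : ℝ), 0, -(1 / √(d : ℝ)), -1]

/-- The relations on `M ∪ (-M)` given by the angles. -/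
def mubRel {d f : ℕ}
    (M : Fin f → OrthonormalBasis (Fin d) ℝ (EuclideanSpace ℝ (Fin d)))
    (k : Fin 5) (x y : mubPoints M) : Prop :=
  inner ℝ (x : EuclideanSpace ℝ (Fin d)) (y : EuclideanSpace ℝ (Fin d)) = mubAngle d k

/-- The adjacency matrices of a scheme are closed under the entrywise product. -/
theorem boseMesner_hadamard {X : Type*} [Fintype X] {n : ℕ} {R : Fin (n + 1) → X → X → Prop}
    (hR : IsSymmetricAssociationScheme R) {A B : Matrix X X ℝ} (hA : A ∈ boseMesner R)
    (hB : B ∈ boseMesner R) : A ⊙ B ∈ boseMesner R := by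
  unfold boseMesner at *
  induction hA using Submodule.span_induction with
  | mem A hA =>
    induction hB using Submodule.span_induction with
    | mem B hB =>
      obtain ⟨i, rfl⟩ := hA
      obtain ⟨j, rfl⟩ := hB
      by_cases hij : i = j
      · subst hij
        have : adjacency R i ⊙ adjacency R i = adjacency R i := by
          ext x y; simp [adjacency]
        rw [this]; exact Submodule.subset_span ⟨i, rfl⟩
      · have : adjacency R i ⊙ adjacency R j = 0 := by
          ext x y
          simp only [adjacency, Matrix.hadamard_apply, Matrix.of_apply, Matrix.zero_apply]
          split_ifs with h1 h2 <;> simp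
          exact hij ((hR.rel_partition x y).unique h1 h2)
        rw [this]; exact Submodule.zero_mem _
    | zero => simp
    | add x y _ _ hx hy => rw [Matrix.hadamard_add]; exact Submodule.add_mem _ hx hy
    | smul a x _ hx => rw [Matrix.hadamard_smul]; exact Submodule.smul_mem _ _ hx
  | zero => simp
  | add x y _ _ hx hy => rw [Matrix.add_hadamard]; exact Submodule.add_mem _ hx hy
  | smul a x _ hx => rw [Matrix.smul_hadamard]; exact Submodule.smul_mem _ _ hx

/-- The defining expansion of the Krein numbers. -/
theorem hadamard_eq_sum_kreinNumber {X : Type*} [Fintype X] [DecidableEq X] {n : ℕ}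
    {R : Fin (n + 1) → X → X → Prop} {E : Fin (n + 1) → Matrix X X ℝ}
    (hR : IsSymmetricAssociationScheme R) (hE : IsPrimitiveIdempotentOrdering R E)
    (i j : Fin (n + 1)) :
    E i ⊙ E j = (Fintype.card X : ℝ)⁻¹ • ∑ k, kreinNumber E i j k • E k := by
  have hmul : ∀ (c : Fin (n + 1) → ℝ) k, (∑ l, c l • E l) * E k = c k • E k := by
    intro c k
    rw [Finset.sum_mul, Finset.sum_eq_single k]
    · rw [Matrix.smul_mul, hE.idem]
    · intro l _ hl; rw [Matrix.smul_mul, hE.orth l k hl, smul_zero]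
    · simp
  have hli : LinearIndependent ℝ E := by
    rw [Fintype.linearIndependent_iff]
    intro c hc k
    have h := hmul c k
    rw [hc, zero_mul] at h
    exact (smul_eq_zero.mp h.symm).resolve_right (hE.ne_zero k)
  have hle : Submodule.span ℝ (Set.range E) ≤ boseMesner R :=
    Submodule.span_le.mpr (by rintro _ ⟨k, rfl⟩; exact hE.mem_boseMesner k)
  have heq : Submodule.span ℝ (Set.range E) = boseMesner R := by
    apply Submodule.eq_of_le_of_finrank_le hle
    rw [finrank_span_eq_card hli]
    exact finrank_range_le_card (R := ℝ) (adjacency R)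
  have hmem : E i ⊙ E j ∈ Submodule.span ℝ (Set.range E) := by
    rw [heq]; exact boseMesner_hadamard hR (hE.mem_boseMesner i) (hE.mem_boseMesner j)
  obtain ⟨c, hc⟩ := (Submodule.mem_span_range_iff_exists_fun ℝ).mp hmem
  have hsymm' : ∀ A ∈ boseMesner R, Aᵀ = A := by
    intro A h
    unfold boseMesner at h
    induction h using Submodule.span_induction with
    | mem A hA =>
      obtain ⟨l, rfl⟩ := hA
      ext x y
      have : R l y x ↔ R l x y := ⟨hR.rel_symm l y x, hR.rel_symm l x y⟩
      by_cases h : R l x y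
      · simp [adjacency, h, this.mpr h]
      · simp [adjacency, h, mt this.mp h]
    | zero => simp
    | add x y _ _ hx hy => rw [Matrix.transpose_add, hx, hy]
    | smul a x _ hx => rw [Matrix.transpose_smul, hx]
  have hsymm : ∀ k, (E k)ᵀ = E k := fun k => hsymm' _ (hE.mem_boseMesner k)
  have htr : ∀ k, (E k).trace ≠ 0 := by
    intro k h
    apply hE.ne_zero k
    rw [← Matrix.trace_conjTranspose_mul_self_eq_zero_iff (A := E k),
      Matrix.conjTranspose_eq_transpose_of_trivial, hsymm, hE.idem, h]
  have hX : (Fintype.card X : ℝ) ≠ 0 := by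
    obtain ⟨x, _⟩ := hR.rel_nonempty 0
    exact_mod_cast (Fintype.card_pos_iff.mpr ⟨x⟩).ne'
  have hk : ∀ k, kreinNumber E i j k = Fintype.card X * c k := by
    intro k
    unfold kreinNumber
    rw [← hc, hmul, Matrix.trace_smul, smul_eq_mul, div_eq_iff (htr k), mul_assoc]
  rw [Finset.smul_sum, ← hc]
  refine Finset.sum_congr rfl fun k _ => ?_
  rw [hk, smul_smul, inv_mul_cancel_left₀ hX]

end

/-! Both halves rest on one dictionary: a scheme as in (1) is the same thing as a set `M ∪ (-M)`
with its five angles. Quadruple regularity is invariant under isomorphism, so it only has to be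
decided for MUB.

From MUB to a scheme. Let J be the all-ones matrix, C the matrix of "same basis up to sign", A the
permutation matrix of `x ↦ -x`, and G the Gram matrix. Each basis together with its negative is a
tight frame, so these matrices multiply by simple rules, and suitable combinations are five
orthogonal idempotents in the span of the five relations. A dimension count shows that they span it,
which gives the intersection numbers. The Krein numbers are read off from entrywise products.

From a scheme to MUB. Tridiagonality, the zero diagonal, antipodality and the column sum d = rank `E
1` determine all `q_{1j}^k` except `c = q_{11}^2`. The resulting recurrences for the entries of the
`E j` leave only the values 0, ±1/√d, ±1 for |X| `E 1` / d (`dual_recurrence_cases`). Since `E 1` is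
a projection of rank d, it is up to scale a Gram matrix in ℝ^d. `E 0 + E 4` is a multiple of an
equivalence relation with classes of size 2d, and each class becomes an orthonormal basis and its
negative.

Regularity. Consider the moment ∑_w ∏_k ⟨x_k, w⟩ of four points. Quadruple regularity makes it a
function of the Gram matrix of the points, so it vanishes when one point is orthogonal to the other
three. Evaluating ∑_w ⟨w₀, w⟩² ⟨e_p, w⟩ ⟨e_q, w⟩ in two ways, for w₀ outside the basis e, then
forces 2(f - 1)/d = 1 (`card_bases_of_isQuadruplyRegular`). Conversely, if f = d/2 + 1, the fourth
moment tensor of `M ∪ (-M)` is at distance 0 from the isotropic tensor (`mubTensor_eq`), so the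
fourth moments depend on the Gram matrix only. Lower moments do so for any f, even over a single
basis, and all the counts are combinations of such moments (`sum_prod_angleBasis_eq`). -/

open scoped Matrix

/-! ### Bose-Mesner spaces, idempotents and invariance under isomorphism -/

/-- The rank of an idempotent real matrix is its trace. -/
theorem Matrix.rank_eq_trace_of_idempotent {X : Type*} [Fintype X] [DecidableEq X]
    {A : Matrix X X ℝ} (hA : A * A = A) : (A.rank : ℝ) = A.trace := by
  have hidem : IsIdempotentElem (Matrix.toLin' A) := by
    rw [IsIdempotentElem, Module.End.mul_eq_comp, ← Matrix.toLin'_mul, hA]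
  have hproj : LinearMap.IsProj (LinearMap.range (Matrix.toLin' A)) (Matrix.toLin' A) :=
    LinearMap.IsIdempotentElem.isProj_range _ hidem
  have h := hproj.trace
  rw [Matrix.trace_toLin'_eq] at h
  rw [h]
  rfl

/-- Quadruple regularity is invariant under isomorphism and relabelling of the relations. -/
theorem IsQuadruplyRegular.of_equiv {X Y : Type*} {n : ℕ} {R : Fin (n + 1) → X → X → Prop}
    {S : Fin (n + 1) → Y → Y → Prop} (φ : X ≃ Y) (σ : Equiv.Perm (Fin (n + 1)))
    (h : ∀ k x y, R k x y ↔ S (σ k) (φ x) (φ y)) (hS : IsQuadruplyRegular S) :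
    IsQuadruplyRegular R := by
  intro i j
  obtain ⟨c, hc⟩ := hS (fun k => σ (i k)) (fun k l => σ (j k l))
  refine ⟨c, fun x hx => ?_⟩
  rw [← hc (fun k => φ (x k)) fun k l hkl => (h _ _ _).mp (hx k l hkl)]
  rw [← Set.ncard_image_of_injective _ φ.injective]
  congr 1
  ext w
  constructor
  · rintro ⟨v, hv, rfl⟩ k
    exact (h _ _ _).mp (hv k)
  · intro hw
    refine ⟨φ.symm w, fun k => ?_, φ.apply_symm_apply w⟩
    rw [h, φ.apply_symm_apply]
    exact hw k

theorem isQuadruplyRegular_iff_of_equiv {X Y : Type*} {n : ℕ} {R : Fin (n + 1) → X → X → Prop}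
    {S : Fin (n + 1) → Y → Y → Prop} (φ : X ≃ Y) (σ : Equiv.Perm (Fin (n + 1)))
    (h : ∀ k x y, R k x y ↔ S (σ k) (φ x) (φ y)) :
    IsQuadruplyRegular R ↔ IsQuadruplyRegular S :=
  ⟨fun hR => hR.of_equiv φ.symm σ.symm fun k x y => by simp [h], fun hS => hS.of_equiv φ σ h⟩

/-- Elements of the Bose-Mesner space are constant on every relation. -/
theorem boseMesner_apply_eq {X : Type*} {n : ℕ} {R : Fin (n + 1) → X → X → Prop}
    (hR : ∀ x y, ∃! i, R i x y) {A : Matrix X X ℝ} (hA : A ∈ boseMesner R)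
    {k : Fin (n + 1)} {x y x' y' : X} (h : R k x y) (h' : R k x' y') : A x y = A x' y' := by
  unfold boseMesner at hA
  induction hA using Submodule.span_induction with
  | mem A hA =>
    obtain ⟨i, rfl⟩ := hA
    have : ∀ {x y}, R k x y → (R i x y ↔ i = k) := fun {x y} hk =>
      ⟨fun hi => (hR x y).unique hi hk, fun e => e ▸ hk⟩
    simp [adjacency, this h, this h']
  | zero => rfl
  | add A B _ _ hA hB => simp [hA, hB]
  | smul a A _ hA => simp [hA]

/-- A matrix constant on every relation lies in the Bose-Mesner space. -/
theorem mem_boseMesner_of_const {X : Type*} {n : ℕ} {R : Fin (n + 1) → X → X → Prop}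
    (hR : ∀ x y, ∃! i, R i x y) {A : Matrix X X ℝ} (c : Fin (n + 1) → ℝ)
    (h : ∀ k x y, R k x y → A x y = c k) : A ∈ boseMesner R := by
  have : A = ∑ k, c k • adjacency R k := by
    ext x y
    obtain ⟨k, hk, huniq⟩ := hR x y
    rw [h k x y hk, Matrix.sum_apply, Finset.sum_eq_single k]
    · simp [adjacency, hk]
    · intro l _ hl
      have : ¬ R l x y := fun hc => hl (huniq l hc)
      simp [adjacency, this]
    · simp
  rw [this]
  exact Submodule.sum_mem _ fun k _ => Submodule.smul_mem _ _ (Submodule.subset_span ⟨k, rfl⟩)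

theorem sum_smul_mul_idempotent {X ι : Type*} [Fintype X] [Fintype ι]
    {E : ι → Matrix X X ℝ} (idem : ∀ i, E i * E i = E i)
    (orth : ∀ i j, i ≠ j → E i * E j = 0) (c : ι → ℝ) (k : ι) :
    (∑ l, c l • E l) * E k = c k • E k := by
  classical
  rw [Finset.sum_mul, Finset.sum_eq_single k]
  · rw [Matrix.smul_mul, idem]
  · intro l _ hl; rw [Matrix.smul_mul, orth l k hl, smul_zero]
  · simp

/-- `n + 1` orthogonal nonzero idempotents in the Bose-Mesner space span it. -/
theorem span_range_idempotent_eq {X : Type*} [Fintype X] {n : ℕ}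
    {R : Fin (n + 1) → X → X → Prop} {E : Fin (n + 1) → Matrix X X ℝ}
    (mem : ∀ i, E i ∈ boseMesner R) (idem : ∀ i, E i * E i = E i)
    (orth : ∀ i j, i ≠ j → E i * E j = 0) (ne_zero : ∀ i, E i ≠ 0) :
    Submodule.span ℝ (Set.range E) = boseMesner R := by
  have hli : LinearIndependent ℝ E := by
    rw [Fintype.linearIndependent_iff]
    intro c hc k
    have h := sum_smul_mul_idempotent idem orth c k
    rw [hc, zero_mul] at h
    exact (smul_eq_zero.mp h.symm).resolve_right (ne_zero k)
  apply Submodule.eq_of_le_of_finrank_le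
    (Submodule.span_le.mpr (by rintro _ ⟨k, rfl⟩; exact mem k))
  rw [finrank_span_eq_card hli]
  exact finrank_range_le_card (R := ℝ) (adjacency R)

/-- A partition into symmetric relations whose Bose-Mesner space is spanned by orthogonal
idempotents has intersection numbers. -/
theorem exists_intersection_number {X : Type*} [Fintype X] {n : ℕ}
    {R : Fin (n + 1) → X → X → Prop} {E : Fin (n + 1) → Matrix X X ℝ}
    (hR : ∀ x y, ∃! i, R i x y)
    (mem : ∀ i, E i ∈ boseMesner R) (idem : ∀ i, E i * E i = E i)
    (orth : ∀ i j, i ≠ j → E i * E j = 0) (ne_zero : ∀ i, E i ≠ 0) (i j k : Fin (n + 1)) :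
    ∃ p : ℕ, ∀ x y, R k x y → {z | R i x z ∧ R j z y}.ncard = p := by
  classical
  have hspan := span_range_idempotent_eq mem idem orth ne_zero
  have hcoef : ∀ l, ∃ c : Fin (n + 1) → ℝ, ∑ m, c m • E m = adjacency R l := fun l => by
    rw [← Submodule.mem_span_range_iff_exists_fun, hspan]
    exact Submodule.subset_span ⟨l, rfl⟩
  -- Expanding the second factor in the idempotents suffices, because the first acts on each `E m`
  -- as a scalar. The entries of the product are the counts in question, and membership makes them
  -- constant on relations.
  have hmul : adjacency R i * adjacency R j ∈ boseMesner R := by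
    obtain ⟨c, hc⟩ := hcoef i
    obtain ⟨c', hc'⟩ := hcoef j
    rw [← hc', Finset.mul_sum]
    refine Submodule.sum_mem _ fun m _ => ?_
    rw [Matrix.mul_smul, ← hc, sum_smul_mul_idempotent idem orth]
    exact Submodule.smul_mem _ _ (Submodule.smul_mem _ _ (mem m))
  have hcount : ∀ x y, (adjacency R i * adjacency R j) x y =
      ({z | R i x z ∧ R j z y}.ncard : ℝ) := by
    intro x y
    rw [Matrix.mul_apply, Set.ncard_eq_toFinset_card']
    simp [adjacency, ← ite_and, and_comm]
  by_cases hk : ∃ x y, R k x y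
  · obtain ⟨x, y, hxy⟩ := hk
    refine ⟨{z | R i x z ∧ R j z y}.ncard, fun x' y' h' => ?_⟩
    have := boseMesner_apply_eq hR hmul h' hxy
    rw [hcount, hcount] at this
    exact_mod_cast this
  · exact ⟨0, fun x y h => absurd ⟨x, y, h⟩ hk⟩

/-- Krein numbers are read off from any expansion of the entrywise product. -/
theorem kreinNumber_eq_of_hadamard_eq {X : Type*} [Fintype X] {n : ℕ}
    {E : Fin (n + 1) → Matrix X X ℝ} (idem : ∀ i, E i * E i = E i)
    (orth : ∀ i j, i ≠ j → E i * E j = 0) {i j : Fin (n + 1)} {c : Fin (n + 1) → ℝ}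
    (h : E i ⊙ E j = ∑ l, c l • E l) {k : Fin (n + 1)} (hk : (E k).trace ≠ 0) :
    kreinNumber E i j k = Fintype.card X * c k := by
  unfold kreinNumber
  rw [h, sum_smul_mul_idempotent idem orth, Matrix.trace_smul, smul_eq_mul, div_eq_iff hk,
    mul_assoc]

/-! ### Inner products in `M ∪ (-M)` and sums over a single basis -/

section MUB

variable {d f : ℕ} {M : Fin f → OrthonormalBasis (Fin d) ℝ (EuclideanSpace ℝ (Fin d))}

theorem inv_sqrt_pos {d : ℕ} (hd : 2 ≤ d) : 0 < 1 / √(d : ℝ) := by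
  have : (0 : ℝ) < d := by exact_mod_cast (by omega : 0 < d)
  positivity

theorem inv_sqrt_sq {d : ℕ} : (1 / √(d : ℝ)) ^ 2 = 1 / d := by
  rw [div_pow, Real.sq_sqrt (Nat.cast_nonneg d), one_pow]

theorem inv_sqrt_lt_one {d : ℕ} (hd : 2 ≤ d) : 1 / √(d : ℝ) < 1 := by
  have h2 : (2 : ℝ) ≤ d := by exact_mod_cast hd
  have := inv_sqrt_pos hd
  have hsq := inv_sqrt_sq (d := d)
  have : (1 : ℝ) / d < 1 := by rw [div_lt_one (by linarith)]; linarith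
  nlinarith

/-- The inner product of two points of `M ∪ (-M)`. -/
noncomputable def mubInner (x y : mubPoints M) : ℝ :=
  inner ℝ (x : EuclideanSpace ℝ (Fin d)) (y : EuclideanSpace ℝ (Fin d))

theorem mubInner_comm (x y : mubPoints M) : mubInner x y = mubInner y x :=
  real_inner_comm _ _

/-- The point `±M a i`, with sign `-` if `s` is true. -/
noncomputable def mubPoint (M : Fin f → OrthonormalBasis (Fin d) ℝ (EuclideanSpace ℝ (Fin d)))
    (p : (Fin f × Fin d) × Bool) : mubPoints M :=
  ⟨if p.2 then -M p.1.1 p.1.2 else M p.1.1 p.1.2, p.1.1, p.1.2, by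
    cases p.2 <;> simp⟩

/-- The antipode of a point. -/
def mubNeg (x : mubPoints M) : mubPoints M :=
  ⟨-x, by
    obtain ⟨a, i, h | h⟩ := x.2
    · exact ⟨a, i, Or.inr (by rw [h])⟩
    · exact ⟨a, i, Or.inl (by rw [h, neg_neg])⟩⟩

@[simp]
theorem mubNeg_mubNeg (x : mubPoints M) : mubNeg (mubNeg x) = x :=
  Subtype.ext (neg_neg _)

@[simp]
theorem mubInner_mubNeg_left (x y : mubPoints M) : mubInner (mubNeg x) y = -mubInner x y :=
  inner_neg_left _ _

@[simp]
theorem mubInner_mubNeg_right (x y : mubPoints M) : mubInner x (mubNeg y) = -mubInner x y :=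
  inner_neg_right _ _

theorem mubPoint_surjective : Function.Surjective (mubPoint M) := by
  rintro ⟨v, a, i, h | h⟩
  · exact ⟨((a, i), false), Subtype.ext (by simp [mubPoint, h])⟩
  · exact ⟨((a, i), true), Subtype.ext (by simp [mubPoint, h])⟩

/-- The sign of a point given by a Boolean. -/
noncomputable def boolSign (s : Bool) : ℝ := if s then -1 else 1

theorem boolSign_eq (s : Bool) : boolSign s = 1 ∨ boolSign s = -1 := by
  cases s <;> simp [boolSign]

theorem mubInner_mubPoint (p q : (Fin f × Fin d) × Bool) :
    mubInner (mubPoint M p) (mubPoint M q) =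
      boolSign p.2 * boolSign q.2 * inner ℝ (M p.1.1 p.1.2) (M q.1.1 q.1.2) := by
  rcases p with ⟨p, s⟩
  rcases q with ⟨q, t⟩
  cases s <;> cases t <;> simp [mubInner, mubPoint, boolSign]

theorem mubInner_mubPoint_same (a : Fin f) (i j : Fin d) (s t : Bool) :
    mubInner (mubPoint M ((a, i), s)) (mubPoint M ((a, j), t)) =
      if i = j then boolSign s * boolSign t else 0 := by
  rw [mubInner_mubPoint]
  simp [orthonormal_iff_ite.mp (M a).orthonormal i j]

theorem mubInner_mubPoint_ne (hM : IsMUB M) {p q : (Fin f × Fin d) × Bool}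
    (h : p.1.1 ≠ q.1.1) :
    mubInner (mubPoint M p) (mubPoint M q) = 1 / √(d : ℝ) ∨
      mubInner (mubPoint M p) (mubPoint M q) = -(1 / √(d : ℝ)) := by
  rw [mubInner_mubPoint]
  rcases boolSign_eq p.2 with hp | hp <;> rcases boolSign_eq q.2 with hq | hq <;>
    rcases hM _ _ h p.1.2 q.1.2 with h | h <;> rw [hp, hq, h] <;> simp

/-- Equal points have inner product 1. Across different bases this is impossible because 1/√d < 1,
which is where d ≥ 2 is needed: for d = 1 all bases coincide up to sign. -/
theorem mubPoint_injective (hd : 2 ≤ d) (hM : IsMUB M) : Function.Injective (mubPoint M) := by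
  rintro ⟨⟨a, i⟩, s⟩ ⟨⟨b, j⟩, t⟩ h
  have h1 : mubInner (mubPoint M ((a, i), s)) (mubPoint M ((b, j), t)) = 1 := by
    rw [← h, mubInner_mubPoint_same, if_pos rfl]
    cases s <;> simp [boolSign]
  have hab : a = b := by
    by_contra hab
    have := inv_sqrt_pos hd
    have := inv_sqrt_lt_one hd
    rcases mubInner_mubPoint_ne hM (p := ((a, i), s)) (q := ((b, j), t)) hab with h | h <;>
      linarith
  subst hab
  rw [mubInner_mubPoint_same] at h1
  split_ifs at h1 with hij
  · subst hij
    cases s <;> cases t <;> simp [boolSign] at h1 ⊢ <;> norm_num at h1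
  · norm_num at h1

/-- The parametrization of `M ∪ (-M)` by basis, index and sign. -/
noncomputable def mubEquiv (hd : 2 ≤ d) (hM : IsMUB M) :
    (Fin f × Fin d) × Bool ≃ mubPoints M :=
  Equiv.ofBijective (mubPoint M) ⟨mubPoint_injective hd hM, mubPoint_surjective⟩

theorem mubEquiv_apply (hd : 2 ≤ d) (hM : IsMUB M) (p : (Fin f × Fin d) × Bool) :
    mubEquiv hd hM p = mubPoint M p := rfl

/-- The index of the basis that contains a point up to sign. -/
noncomputable def mubIdx (x : mubPoints M) : Fin f :=
  (mubPoint_surjective x).choose.1.1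

theorem mubIdx_mubPoint (hd : 2 ≤ d) (hM : IsMUB M) (p : (Fin f × Fin d) × Bool) :
    mubIdx (mubPoint M p) = p.1.1 := by
  have := (mubPoint_surjective (mubPoint M p)).choose_spec
  unfold mubIdx
  rw [mubPoint_injective hd hM this]

theorem mubNeg_mubPoint (p : Fin f × Fin d) (s : Bool) :
    mubNeg (mubPoint M (p, s)) = mubPoint M (p, !s) := by
  apply Subtype.ext
  cases s <;> simp [mubNeg, mubPoint]

theorem mubIdx_mubNeg (hd : 2 ≤ d) (hM : IsMUB M) (x : mubPoints M) :
    mubIdx (mubNeg x) = mubIdx x := by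
  obtain ⟨⟨p, s⟩, rfl⟩ := mubPoint_surjective x
  rw [mubNeg_mubPoint, mubIdx_mubPoint hd hM, mubIdx_mubPoint hd hM]

@[simp]
theorem mubInner_self (x : mubPoints M) : mubInner x x = 1 := by
  obtain ⟨⟨⟨a, i⟩, s⟩, rfl⟩ := mubPoint_surjective x
  rw [mubInner_mubPoint_same, if_pos rfl]
  cases s <;> simp [boolSign]

theorem mubInner_of_mubIdx_eq (hd : 2 ≤ d) (hM : IsMUB M) {x y : mubPoints M}
    (h : mubIdx x = mubIdx y) : x = y ∨ x = mubNeg y ∨ mubInner x y = 0 := by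
  obtain ⟨⟨⟨a, i⟩, s⟩, rfl⟩ := mubPoint_surjective x
  obtain ⟨⟨⟨b, j⟩, t⟩, rfl⟩ := mubPoint_surjective y
  rw [mubIdx_mubPoint hd hM, mubIdx_mubPoint hd hM] at h
  obtain rfl : a = b := h
  rw [mubNeg_mubPoint, mubInner_mubPoint_same]
  by_cases hij : i = j
  · subst hij
    cases s <;> cases t <;> simp
  · simp [hij]

theorem mubInner_of_mubIdx_ne (hd : 2 ≤ d) (hM : IsMUB M) {x y : mubPoints M}
    (h : mubIdx x ≠ mubIdx y) :
    mubInner x y = 1 / √(d : ℝ) ∨ mubInner x y = -(1 / √(d : ℝ)) := by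
  obtain ⟨p, rfl⟩ := mubPoint_surjective x
  obtain ⟨q, rfl⟩ := mubPoint_surjective y
  rw [mubIdx_mubPoint hd hM, mubIdx_mubPoint hd hM] at h
  exact mubInner_mubPoint_ne hM h

theorem mubInner_sq_of_mubIdx_ne (hd : 2 ≤ d) (hM : IsMUB M) {x y : mubPoints M}
    (h : mubIdx x ≠ mubIdx y) : mubInner x y ^ 2 = 1 / d := by
  rcases mubInner_of_mubIdx_ne hd hM h with h | h <;> rw [h]
  · exact inv_sqrt_sq
  · rw [neg_sq, inv_sqrt_sq]

theorem mubInner_eq_one_iff {x y : mubPoints M} : mubInner x y = 1 ↔ x = y := by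
  refine ⟨fun h => Subtype.ext ?_, fun h => by rw [h, mubInner_self]⟩
  have hn : ∀ z : mubPoints M, ‖(z : EuclideanSpace ℝ (Fin d))‖ = 1 := fun z => by
    have := mubInner_self z
    rw [mubInner, real_inner_self_eq_norm_sq] at this
    nlinarith [norm_nonneg (z : EuclideanSpace ℝ (Fin d))]
  exact (inner_eq_one_iff_of_norm_eq_one (hn x) (hn y)).mp h

theorem mubInner_eq_neg_one_iff {x y : mubPoints M} : mubInner x y = -1 ↔ x = mubNeg y := by
  rw [← mubInner_eq_one_iff, mubInner_mubNeg_right, neg_eq_iff_eq_neg]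

theorem mubNeg_ne (x : mubPoints M) : mubNeg x ≠ x := by
  intro h
  have := mubInner_mubNeg_left x x
  rw [h, mubInner_self] at this
  norm_num at this

/-- Points lie in the same class exactly if their inner product is `0` or `±1`. -/
theorem mubIdx_eq_iff (hd : 2 ≤ d) (hM : IsMUB M) {x y : mubPoints M} :
    mubIdx x = mubIdx y ↔ mubInner x y = 0 ∨ mubInner x y = 1 ∨ mubInner x y = -1 := by
  constructor
  · intro h
    rcases mubInner_of_mubIdx_eq hd hM h with h | h | h
    · exact Or.inr (Or.inl (mubInner_eq_one_iff.mpr h))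
    · exact Or.inr (Or.inr (mubInner_eq_neg_one_iff.mpr h))
    · exact Or.inl h
  · intro h
    by_contra hne
    have := inv_sqrt_pos hd
    have := inv_sqrt_lt_one hd
    rcases mubInner_of_mubIdx_ne hd hM hne with h' | h' <;> rcases h with h | h | h <;> linarith

/-- The sum over the points of a class. -/
theorem sum_class_eq (hd : 2 ≤ d) (hM : IsMUB M) (a : Fin f) (F : mubPoints M → ℝ) :
    ∑ w, (if mubIdx w = a then F w else 0) =
      ∑ i, (F (mubPoint M ((a, i), false)) + F (mubPoint M ((a, i), true))) := by
  rw [← (mubEquiv hd hM).sum_comp]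
  simp only [mubEquiv_apply, mubIdx_mubPoint hd hM]
  rw [Fintype.sum_prod_type, Fintype.sum_prod_type, Finset.sum_eq_single a]
  · simp [add_comm]
  · intro b _ hb
    simp [hb]
  · simp

theorem sum_eq_sum_class (F : mubPoints M → ℝ) :
    ∑ w, F w = ∑ a, ∑ w, (if mubIdx w = a then F w else 0) := by
  rw [Finset.sum_comm]
  simp

theorem sum_class_one (hd : 2 ≤ d) (hM : IsMUB M) (a : Fin f) :
    ∑ w : mubPoints M, (if mubIdx w = a then (1 : ℝ) else 0) = 2 * d := by
  rw [sum_class_eq hd hM a fun _ => 1]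
  simp
  ring

/-- Each class is a tight frame. -/
theorem sum_class_mul (hd : 2 ≤ d) (hM : IsMUB M) (a : Fin f) (x y : mubPoints M) :
    ∑ w, (if mubIdx w = a then mubInner x w * mubInner y w else 0) = 2 * mubInner x y := by
  rw [sum_class_eq hd hM a fun w => mubInner x w * mubInner y w]
  unfold mubInner
  rw [← (M a).sum_inner_mul_inner, Finset.mul_sum]
  refine Finset.sum_congr rfl fun i _ => ?_
  simp only [mubPoint, if_true, Bool.false_eq_true, if_false, inner_neg_right]
  rw [real_inner_comm (y : EuclideanSpace ℝ (Fin d)) (M a i)]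
  ring

theorem sum_mubInner_mul (hd : 2 ≤ d) (hM : IsMUB M) (x y : mubPoints M) :
    ∑ w, mubInner x w * mubInner y w = 2 * f * mubInner x y := by
  rw [sum_eq_sum_class]
  simp only [sum_class_mul hd hM]
  simp
  ring

theorem card_mubPoints (hd : 2 ≤ d) (hM : IsMUB M) :
    (Fintype.card (mubPoints M) : ℝ) = 2 * d * f := by
  rw [← Fintype.card_congr (mubEquiv hd hM)]
  simp
  ring

/-- Antipodal points cancel in the sum of an odd function over a class. -/
theorem sum_class_odd (hd : 2 ≤ d) (hM : IsMUB M) (a : Fin f) (F : mubPoints M → ℝ)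
    (hF : ∀ w, F (mubNeg w) = -F w) : ∑ w, (if mubIdx w = a then F w else 0) = 0 := by
  have h := Equiv.sum_comp (Function.Involutive.toPerm (mubNeg (M := M)) mubNeg_mubNeg)
    fun w => if mubIdx w = a then F w else 0
  have h' : ∑ w, (if mubIdx (mubNeg w) = a then F (mubNeg w) else 0) =
      -∑ w, (if mubIdx w = a then F w else 0) := by
    rw [← Finset.sum_neg_distrib]
    refine Finset.sum_congr rfl fun w _ => ?_
    rw [mubIdx_mubNeg hd hM, hF]
    split_ifs <;> simp
  change ∑ w, (if mubIdx (mubNeg w) = a then F (mubNeg w) else 0) = _ at h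
  linarith

/-- On the class of `x`, a factor `⟨x, w⟩` concentrates the sum at `±x`. -/
theorem sum_class_mubInner_mul (hd : 2 ≤ d) (hM : IsMUB M) (x : mubPoints M)
    (F : mubPoints M → ℝ) :
    ∑ w, (if mubIdx w = mubIdx x then mubInner x w * F w else 0) = F x - F (mubNeg x) := by
  rw [← Finset.sum_subset (Finset.subset_univ {x, mubNeg x}),
    Finset.sum_pair (mubNeg_ne x).symm]
  · simp [mubIdx_mubNeg hd hM, sub_eq_add_neg]
  · intro w _ hw
    simp only [Finset.mem_insert, Finset.mem_singleton, not_or] at hw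
    split_ifs with h
    · rcases mubInner_of_mubIdx_eq hd hM h with h | h | h
      · exact absurd h hw.1
      · exact absurd h hw.2
      · rw [mubInner_comm, h, zero_mul]
    · rfl

end MUB

/-! ### The association scheme on `M ∪ (-M)` and its Krein numbers -/

section MUBScheme

variable {d f : ℕ} {M : Fin f → OrthonormalBasis (Fin d) ℝ (EuclideanSpace ℝ (Fin d))}

theorem mubAngle_injective (hd : 2 ≤ d) : Function.Injective (mubAngle d) := by
  have h0 := inv_sqrt_pos hd
  have h1 := inv_sqrt_lt_one hd
  intro i j h
  unfold mubAngle at h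
  generalize 1 / √(d : ℝ) = s at h h0 h1
  fin_cases i <;> fin_cases j <;> simp at h ⊢ <;> linarith

theorem exists_mubInner_eq_mubAngle (hd : 2 ≤ d) (hM : IsMUB M) (x y : mubPoints M) :
    ∃ k, mubInner x y = mubAngle d k := by
  by_cases h : mubIdx x = mubIdx y
  · rcases (mubIdx_eq_iff hd hM).mp h with h | h | h
    · exact ⟨2, h⟩
    · exact ⟨0, h⟩
    · exact ⟨4, h⟩
  · rcases mubInner_of_mubIdx_ne hd hM h with h | h
    · exact ⟨1, h⟩
    · exact ⟨3, h⟩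

theorem mubRel_iff {k : Fin 5} {x y : mubPoints M} :
    mubRel M k x y ↔ mubInner x y = mubAngle d k := Iff.rfl

theorem mubRel_partition (hd : 2 ≤ d) (hM : IsMUB M) (x y : mubPoints M) :
    ∃! k, mubRel M k x y := by
  obtain ⟨k, hk⟩ := exists_mubInner_eq_mubAngle hd hM x y
  exact ⟨k, hk, fun l hl => mubAngle_injective hd (hl.symm.trans hk)⟩

theorem mubRel_nonempty (hd : 2 ≤ d) (hf : 2 ≤ f) (hM : IsMUB M) (k : Fin 5) :
    ∃ x y, mubRel M k x y := by
  let i : Fin d := ⟨0, by omega⟩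
  let j : Fin d := ⟨1, by omega⟩
  let a : Fin f := ⟨0, by omega⟩
  let b : Fin f := ⟨1, by omega⟩
  let x := mubPoint M ((a, i), false)
  let y := mubPoint M ((b, i), false)
  have hxy : mubInner x y = 1 / √(d : ℝ) ∨ mubInner x y = -(1 / √(d : ℝ)) :=
    mubInner_mubPoint_ne hM (by simp [a, b])
  simp only [mubRel_iff]
  fin_cases k
  · exact ⟨x, x, mubInner_self x⟩
  · rcases hxy with h | h
    · exact ⟨x, y, h⟩
    · exact ⟨x, mubNeg y, by rw [mubInner_mubNeg_right, h, neg_neg]; rfl⟩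
  · refine ⟨x, mubPoint M ((a, j), false), ?_⟩
    rw [mubInner_mubPoint_same, if_neg (by simp [i, j])]
    rfl
  · rcases hxy with h | h
    · exact ⟨x, mubNeg y, by rw [mubInner_mubNeg_right, h]; rfl⟩
    · exact ⟨x, y, h⟩
  · exact ⟨x, mubNeg x, by rw [mubInner_mubNeg_right, mubInner_self]; rfl⟩

/-- The Gram matrix of `M ∪ (-M)`. -/
noncomputable def mubGram (M : Fin f → OrthonormalBasis (Fin d) ℝ (EuclideanSpace ℝ (Fin d))) :
    Matrix (mubPoints M) (mubPoints M) ℝ := Matrix.of mubInner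

/-- The matrix of the relation of lying in the same basis up to sign. -/
noncomputable def mubClassMatrix
    (M : Fin f → OrthonormalBasis (Fin d) ℝ (EuclideanSpace ℝ (Fin d))) :
    Matrix (mubPoints M) (mubPoints M) ℝ :=
  Matrix.of fun x y => if mubIdx x = mubIdx y then 1 else 0

/-- The permutation matrix of `x ↦ -x`. -/
noncomputable def mubNegMatrix
    (M : Fin f → OrthonormalBasis (Fin d) ℝ (EuclideanSpace ℝ (Fin d))) :
    Matrix (mubPoints M) (mubPoints M) ℝ :=
  Matrix.of fun x y => if x = mubNeg y then 1 else 0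

/-- The all-ones matrix on `M ∪ (-M)`. -/
def mubOnes (M : Fin f → OrthonormalBasis (Fin d) ℝ (EuclideanSpace ℝ (Fin d))) :
    Matrix (mubPoints M) (mubPoints M) ℝ :=
  Matrix.of fun _ _ => 1

theorem eq_mubNeg_iff {x y : mubPoints M} : x = mubNeg y ↔ mubNeg x = y :=
  ⟨fun h => by rw [h, mubNeg_mubNeg], fun h => by rw [← h, mubNeg_mubNeg]⟩

theorem mubNegMatrix_mul (B : Matrix (mubPoints M) (mubPoints M) ℝ) (x y : mubPoints M) :
    (mubNegMatrix M * B) x y = B (mubNeg x) y := by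
  simp only [Matrix.mul_apply, mubNegMatrix, Matrix.of_apply, eq_mubNeg_iff]
  simp

theorem mul_mubNegMatrix (B : Matrix (mubPoints M) (mubPoints M) ℝ) (x y : mubPoints M) :
    (B * mubNegMatrix M) x y = B x (mubNeg y) := by
  simp [Matrix.mul_apply, mubNegMatrix]

theorem mubNegMatrix_sq : mubNegMatrix M * mubNegMatrix M = 1 := by
  ext x y
  rw [mubNegMatrix_mul]
  simp only [mubNegMatrix, Matrix.of_apply, Matrix.one_apply]
  simp [eq_mubNeg_iff]

theorem mubNegMatrix_mul_class (hd : 2 ≤ d) (hM : IsMUB M) :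
    mubNegMatrix M * mubClassMatrix M = mubClassMatrix M := by
  ext x y
  simp [mubNegMatrix_mul, mubClassMatrix, mubIdx_mubNeg hd hM]

theorem mubClass_mul_neg (hd : 2 ≤ d) (hM : IsMUB M) :
    mubClassMatrix M * mubNegMatrix M = mubClassMatrix M := by
  ext x y
  simp [mul_mubNegMatrix, mubClassMatrix, mubIdx_mubNeg hd hM]

theorem mubNegMatrix_mul_gram : mubNegMatrix M * mubGram M = -mubGram M := by
  ext x y
  simp [mubNegMatrix_mul, mubGram]

theorem mubGram_mul_neg : mubGram M * mubNegMatrix M = -mubGram M := by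
  ext x y
  simp [mul_mubNegMatrix, mubGram]

theorem mubGram_sq (hd : 2 ≤ d) (hM : IsMUB M) :
    mubGram M * mubGram M = (2 * f : ℝ) • mubGram M := by
  ext x y
  simp only [Matrix.mul_apply, mubGram, Matrix.of_apply, Matrix.smul_apply, smul_eq_mul]
  rw [← sum_mubInner_mul hd hM]
  exact Finset.sum_congr rfl fun w _ => by rw [mubInner_comm w y]

theorem mubClass_sq (hd : 2 ≤ d) (hM : IsMUB M) :
    mubClassMatrix M * mubClassMatrix M = (2 * d : ℝ) • mubClassMatrix M := by
  ext x y
  simp only [Matrix.mul_apply, mubClassMatrix, Matrix.of_apply, Matrix.smul_apply, smul_eq_mul]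
  rw [← sum_class_one hd hM (mubIdx y), Finset.sum_mul]
  refine Finset.sum_congr rfl fun w _ => ?_
  by_cases h : mubIdx w = mubIdx y <;> simp [h]

theorem mubClass_mul_ones (hd : 2 ≤ d) (hM : IsMUB M) :
    mubClassMatrix M * mubOnes M = (2 * d : ℝ) • mubOnes M := by
  ext x y
  simp only [Matrix.mul_apply, mubClassMatrix, mubOnes, Matrix.of_apply, Matrix.smul_apply,
    smul_eq_mul, mul_one]
  rw [← sum_class_one hd hM (mubIdx x)]
  exact Finset.sum_congr rfl fun w _ => by simp [eq_comm]

theorem mubOnes_mul_class (hd : 2 ≤ d) (hM : IsMUB M) :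
    mubOnes M * mubClassMatrix M = (2 * d : ℝ) • mubOnes M := by
  ext x y
  simp only [Matrix.mul_apply, mubClassMatrix, mubOnes, Matrix.of_apply, Matrix.smul_apply,
    smul_eq_mul, mul_one, one_mul]
  exact sum_class_one hd hM (mubIdx y)

theorem mubOnes_sq (hd : 2 ≤ d) (hM : IsMUB M) :
    mubOnes M * mubOnes M = (2 * d * f : ℝ) • mubOnes M := by
  ext x y
  rw [← card_mubPoints hd hM]
  simp [Matrix.mul_apply, mubOnes]

/-- Idempotents obtained from a chain `p ≤ c ≤ s` and a `g ≤ 1 - s`. -/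
def chainIdempotents {A : Type*} [Ring A] (p c s g : A) : Fin 5 → A :=
  ![p, g, s - c, 1 - s - g, c - p]

/-- The remaining products follow by absorption along the chain, for example c g = c s g = 0. In the
application p and c average over all points and over a basis with its negative, s symmetrizes under
`x ↦ -x`, and g is the scaled Gram matrix, which lives on odd functions. The order of the list is
the `Q`-polynomial one. -/
theorem chainIdempotents_spec {A : Type*} [Ring A] {p c s g : A} (hp : p * p = p)
    (hc : c * c = c) (hs : s * s = s) (hg : g * g = g) (hpc : p * c = p) (hcp : c * p = p)
    (hcs : c * s = c) (hsc : s * c = c) (hgs : g * s = 0) (hsg : s * g = 0) :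
    (∀ i, chainIdempotents p c s g i * chainIdempotents p c s g i = chainIdempotents p c s g i) ∧
    (∀ i j, i ≠ j → chainIdempotents p c s g i * chainIdempotents p c s g j = 0) ∧
    ∑ i, chainIdempotents p c s g i = 1 := by
  have hps : p * s = p := by rw [← hpc, mul_assoc, hcs]
  have hsp : s * p = p := by rw [← hcp, ← mul_assoc, hsc]
  have hcg : c * g = 0 := by rw [← hcs, mul_assoc, hsg, mul_zero]
  have hgc : g * c = 0 := by rw [← hsc, ← mul_assoc, hgs, zero_mul]
  have hpg : p * g = 0 := by rw [← hps, mul_assoc, hsg, mul_zero]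
  have hgp : g * p = 0 := by rw [← hsp, ← mul_assoc, hgs, zero_mul]
  refine ⟨fun i => ?_, fun i j hij => ?_, ?_⟩
  · fin_cases i <;> simp [chainIdempotents, mul_sub, sub_mul, *]
  · fin_cases i <;> fin_cases j <;>
      first
        | exact absurd rfl hij
        | simp [chainIdempotents, mul_sub, sub_mul, hp, hc, hs, hg, hpc, hcp, hcs, hsc, hgs, hsg,
            hps, hsp, hcg, hgc, hpg, hgp]
  · simp [chainIdempotents, Fin.sum_univ_five]
    abel

/-- The primitive idempotents of the scheme on `M ∪ (-M)`. -/
noncomputable def mubIdempotent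
    (M : Fin f → OrthonormalBasis (Fin d) ℝ (EuclideanSpace ℝ (Fin d))) :
    Fin 5 → Matrix (mubPoints M) (mubPoints M) ℝ :=
  chainIdempotents ((2 * d * f : ℝ)⁻¹ • mubOnes M) ((2 * d : ℝ)⁻¹ • mubClassMatrix M)
    ((2 : ℝ)⁻¹ • (1 + mubNegMatrix M)) ((2 * f : ℝ)⁻¹ • mubGram M)

theorem mubIdempotent_spec (hd : 2 ≤ d) (hf : 2 ≤ f) (hM : IsMUB M) :
    (∀ i, mubIdempotent M i * mubIdempotent M i = mubIdempotent M i) ∧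
    (∀ i j, i ≠ j → mubIdempotent M i * mubIdempotent M j = 0) ∧
    ∑ i, mubIdempotent M i = 1 := by
  have hd0 : (d : ℝ) ≠ 0 := by exact_mod_cast (by omega : d ≠ 0)
  have hf0 : (f : ℝ) ≠ 0 := by exact_mod_cast (by omega : f ≠ 0)
  apply chainIdempotents_spec
  · rw [smul_mul_smul_comm, mubOnes_sq hd hM, smul_smul]
    congr 1; field_simp
  · rw [smul_mul_smul_comm, mubClass_sq hd hM, smul_smul]
    congr 1; field_simp
  · rw [smul_mul_smul_comm, mul_add, add_mul, add_mul, mubNegMatrix_sq, mul_one, mul_one, one_mul,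
      add_comm (mubNegMatrix M) 1, ← two_smul ℝ, smul_smul]
    congr 1; norm_num
  · rw [smul_mul_smul_comm, mubGram_sq hd hM, smul_smul]
    congr 1; field_simp
  · rw [smul_mul_smul_comm, mubOnes_mul_class hd hM, smul_smul]
    congr 1; field_simp
  · rw [smul_mul_smul_comm, mubClass_mul_ones hd hM, smul_smul]
    congr 1; field_simp
  · rw [smul_mul_smul_comm, mul_add, mul_one, mubClass_mul_neg hd hM, ← two_smul ℝ, smul_smul]
    congr 1; field_simp
  · rw [smul_mul_smul_comm, add_mul, one_mul, mubNegMatrix_mul_class hd hM, ← two_smul ℝ,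
      smul_smul]
    congr 1; field_simp
  · rw [smul_mul_smul_comm, mul_add, mul_one, mubGram_mul_neg, add_neg_cancel, smul_zero]
  · rw [smul_mul_smul_comm, add_mul, one_mul, mubNegMatrix_mul_gram, add_neg_cancel, smul_zero]

theorem mem_boseMesner_of_eq_mubInner (hd : 2 ≤ d) (hM : IsMUB M) (h : ℝ → ℝ)
    {B : Matrix (mubPoints M) (mubPoints M) ℝ} (hB : ∀ x y, B x y = h (mubInner x y)) :
    B ∈ boseMesner (mubRel M) :=
  mem_boseMesner_of_const (mubRel_partition hd hM) (fun k => h (mubAngle d k))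
    fun k x y hk => by rw [hB, mubRel_iff.mp hk]

open Classical in
theorem mubIdempotent_mem (hd : 2 ≤ d) (hM : IsMUB M) (i : Fin 5) :
    mubIdempotent M i ∈ boseMesner (mubRel M) := by
  have h1 : (1 : Matrix (mubPoints M) (mubPoints M) ℝ) ∈ boseMesner (mubRel M) :=
    mem_boseMesner_of_eq_mubInner hd hM (fun t => if t = 1 then 1 else 0) fun x y => by
      simp [Matrix.one_apply, mubInner_eq_one_iff]
  have hA : mubNegMatrix M ∈ boseMesner (mubRel M) :=
    mem_boseMesner_of_eq_mubInner hd hM (fun t => if t = -1 then 1 else 0) fun x y => by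
      simp [mubNegMatrix, mubInner_eq_neg_one_iff]
  have hC : mubClassMatrix M ∈ boseMesner (mubRel M) :=
    mem_boseMesner_of_eq_mubInner hd hM (fun t => if t = 0 ∨ t = 1 ∨ t = -1 then 1 else 0)
      fun x y => by simp [mubClassMatrix, mubIdx_eq_iff hd hM]
  have hJ : mubOnes M ∈ boseMesner (mubRel M) :=
    mem_boseMesner_of_eq_mubInner hd hM (fun _ => 1) fun x y => rfl
  have hG : mubGram M ∈ boseMesner (mubRel M) :=
    mem_boseMesner_of_eq_mubInner hd hM id fun x y => rfl
  have hS := Submodule.smul_mem _ (2⁻¹ : ℝ) (Submodule.add_mem _ h1 hA)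
  have hC' := Submodule.smul_mem _ (2 * d : ℝ)⁻¹ hC
  have hJ' := Submodule.smul_mem _ (2 * d * f : ℝ)⁻¹ hJ
  have hG' := Submodule.smul_mem _ (2 * f : ℝ)⁻¹ hG
  fin_cases i
  · exact hJ'
  · exact hG'
  · exact Submodule.sub_mem _ hS hC'
  · exact Submodule.sub_mem _ (Submodule.sub_mem _ h1 hS) hG'
  · exact Submodule.sub_mem _ hC' hJ'

/-- The diagonal entries 1/(2df), 1/(2f), (1 - 1/d)/2, (1 - 1/f)/2 and (1 - 1/f)/(2d) are all
positive. The bounds on d and f exclude the degenerate cases in which an idempotent vanishes. -/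
theorem mubIdempotent_trace_pos (hd : 2 ≤ d) (hf : 2 ≤ f) (i : Fin 5) :
    0 < (mubIdempotent M i).trace := by
  have hd2 : (2 : ℝ) ≤ d := by exact_mod_cast hd
  have hf2 : (2 : ℝ) ≤ f := by exact_mod_cast hf
  have hdinv : (d : ℝ)⁻¹ ≤ 2⁻¹ := inv_anti₀ (by norm_num) hd2
  have hfinv : (f : ℝ)⁻¹ ≤ 2⁻¹ := inv_anti₀ (by norm_num) hf2
  have hd0 : 0 < (d : ℝ)⁻¹ := by positivity
  have hf0 : 0 < (f : ℝ)⁻¹ := by positivity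
  have hne : (Finset.univ : Finset (mubPoints M)).Nonempty :=
    ⟨mubPoint M ((⟨0, by omega⟩, ⟨0, by omega⟩), false), Finset.mem_univ _⟩
  apply Finset.sum_pos _ hne
  intro x _
  have hx : x ≠ mubNeg x := (mubNeg_ne x).symm
  fin_cases i <;> simp [mubIdempotent, chainIdempotents, mubOnes, mubClassMatrix, mubNegMatrix,
    mubGram, hx] <;> nlinarith

/-- The Krein numbers `q_{1j}^k` of the scheme on `M ∪ (-M)`. -/
noncomputable def mubKrein (d f : ℕ) : Fin 5 → Fin 5 → ℝ :=
  ![![0, 1, 0, 0, 0],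
    ![d, 0, d / f, 0, 0],
    ![0, d - 1, 0, d - 1, 0],
    ![0, 0, d - d / f, 0, d],
    ![0, 0, 0, 1, 0]]

/-- A check of entries for the four kinds of pairs: equal, antipodal, orthogonal in one basis, and
from different bases. In the last case the sign of the inner product is irrelevant and only its
square 1/d enters. -/
theorem mubIdempotent_hadamard (hd : 2 ≤ d) (hf : 2 ≤ f) (hM : IsMUB M) (j : Fin 5) :
    mubIdempotent M 1 ⊙ mubIdempotent M j =
      ∑ k, ((2 * d * f : ℝ)⁻¹ * mubKrein d f j k) • mubIdempotent M k := by
  have hd0 : (d : ℝ) ≠ 0 := by exact_mod_cast (by omega : d ≠ 0)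
  have hf0 : (f : ℝ) ≠ 0 := by exact_mod_cast (by omega : f ≠ 0)
  ext x y
  simp only [Fin.sum_univ_five, Matrix.add_apply, Matrix.smul_apply, Matrix.hadamard_apply]
  by_cases h : mubIdx x = mubIdx y
  · rcases mubInner_of_mubIdx_eq hd hM h with rfl | rfl | h0
    · have hx : x ≠ mubNeg x := (mubNeg_ne x).symm
      fin_cases j <;> simp [mubIdempotent, chainIdempotents, mubOnes, mubClassMatrix,
        mubNegMatrix, mubGram, hx, mubKrein] <;> field_simp <;> ring
    · fin_cases j <;> simp [mubIdempotent, chainIdempotents, mubOnes, mubClassMatrix,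
        mubNegMatrix, mubGram, mubIdx_mubNeg hd hM, mubNeg_ne, mubKrein] <;>
        field_simp <;> ring
    · have h1 : x ≠ y := fun e => by rw [e, mubInner_self] at h0; norm_num at h0
      have h2 : x ≠ mubNeg y := fun e => by
        rw [e, mubInner_mubNeg_left, mubInner_self] at h0; norm_num at h0
      fin_cases j <;> simp [mubIdempotent, chainIdempotents, mubOnes, mubClassMatrix,
        mubNegMatrix, mubGram, h, h0, h1, h2, mubKrein] <;>
        field_simp <;> ring
  · have h1 : x ≠ y := fun e => h (by rw [e])
    have h2 : x ≠ mubNeg y := fun e => h (by rw [e, mubIdx_mubNeg hd hM])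
    have hsq := mubInner_sq_of_mubIdx_ne hd hM h
    have hsq' : mubInner x y ^ 2 * d = 1 := by rw [hsq]; field_simp
    fin_cases j <;> simp [mubIdempotent, chainIdempotents, mubOnes, mubClassMatrix,
      mubNegMatrix, mubGram, h, h1, h2, mubKrein] <;>
      field_simp <;> linear_combination hsq'

theorem mubIdempotent_isPrimitiveIdempotentOrdering (hd : 2 ≤ d) (hf : 2 ≤ f) (hM : IsMUB M) :
    IsPrimitiveIdempotentOrdering (mubRel M) (mubIdempotent M) where
  mem_boseMesner := mubIdempotent_mem hd hM
  zero_eq := by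
    ext x y
    rw [Matrix.of_apply, card_mubPoints hd hM]
    simp [mubIdempotent, chainIdempotents, mubOnes]
  idem := (mubIdempotent_spec hd hf hM).1
  orth := (mubIdempotent_spec hd hf hM).2.1
  sum_eq_one := (mubIdempotent_spec hd hf hM).2.2
  ne_zero i h := by
    have := mubIdempotent_trace_pos (M := M) hd hf i
    rw [h, Matrix.trace_zero] at this
    exact lt_irrefl _ this

theorem mubRel_isSymmetricAssociationScheme (hd : 2 ≤ d) (hf : 2 ≤ f) (hM : IsMUB M) :
    IsSymmetricAssociationScheme (mubRel M) where
  rel_nonempty := mubRel_nonempty hd hf hM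
  rel_partition := mubRel_partition hd hM
  rel_zero_iff _ _ := mubInner_eq_one_iff
  rel_symm k x y h := by
    rw [mubRel_iff, mubInner_comm]
    exact h
  intersection_number :=
    have hE := mubIdempotent_isPrimitiveIdempotentOrdering hd hf hM
    exists_intersection_number (mubRel_partition hd hM) hE.mem_boseMesner hE.idem hE.orth
      hE.ne_zero

theorem kreinNumber_mubIdempotent (hd : 2 ≤ d) (hf : 2 ≤ f) (hM : IsMUB M) (j k : Fin 5) :
    kreinNumber (mubIdempotent M) 1 j k = mubKrein d f j k := by
  have hd0 : (d : ℝ) ≠ 0 := by exact_mod_cast (by omega : d ≠ 0)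
  have hf0 : (f : ℝ) ≠ 0 := by exact_mod_cast (by omega : f ≠ 0)
  rw [kreinNumber_eq_of_hadamard_eq (mubIdempotent_spec hd hf hM).1
    (mubIdempotent_spec hd hf hM).2.1 (mubIdempotent_hadamard hd hf hM j)
    (mubIdempotent_trace_pos hd hf k).ne', card_mubPoints hd hM]
  field_simp

/-- The delicate off-diagonal entries are d - 1 and d - d/f; they are nonzero because d ≥ 2 and f ≥
2. -/
theorem mubIdempotent_isQPolynomial (hd : 2 ≤ d) (hf : 2 ≤ f) (hM : IsMUB M) :
    IsQPolynomial (mubIdempotent M) := by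
  have hd2 : (2 : ℝ) ≤ d := by exact_mod_cast hd
  have hf2 : (2 : ℝ) ≤ f := by exact_mod_cast hf
  have h1 : (d : ℝ) ≠ 0 := by linarith
  have h2 : (f : ℝ) ≠ 0 := by linarith
  have h3 : (d : ℝ) - 1 ≠ 0 := by linarith
  have h4 : (d : ℝ) - d / f ≠ 0 := by
    have : (d : ℝ) / f < d := div_lt_self (by linarith) (by linarith)
    linarith
  have h5 : d ≠ 0 := by omega
  have h6 : f ≠ 0 := by omega
  intro j k
  rw [kreinNumber_mubIdempotent hd hf hM]
  fin_cases j <;> fin_cases k <;> simp [mubKrein, h3, h4, h5, h6]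

theorem mubIdempotent_isQAntipodal (hd : 2 ≤ d) (hf : 2 ≤ f) (hM : IsMUB M) :
    IsQAntipodal (mubIdempotent M) := by
  intro j hj
  simp only [kreinB, kreinC, kreinNumber_mubIdempotent hd hf hM]
  fin_cases j <;> simp [mubKrein, Fin.rev] at hj ⊢

theorem mubIdempotent_isQBipartite (hd : 2 ≤ d) (hf : 2 ≤ f) (hM : IsMUB M) :
    IsQBipartite (mubIdempotent M) := by
  intro j
  rw [kreinA, kreinNumber_mubIdempotent hd hf hM]
  fin_cases j <;> simp [mubKrein]

theorem rank_mubIdempotent_one (hd : 2 ≤ d) (hf : 2 ≤ f) (hM : IsMUB M) :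
    (mubIdempotent M 1).rank = d := by
  have hf0 : (f : ℝ) ≠ 0 := by exact_mod_cast (by omega : f ≠ 0)
  have h := Matrix.rank_eq_trace_of_idempotent ((mubIdempotent_spec hd hf hM).1 1)
  have ht : (mubIdempotent M 1).trace = d := by
    have hdiag : ∀ x, mubIdempotent M 1 x x = (2 * f : ℝ)⁻¹ := fun x => by
      simp [mubIdempotent, chainIdempotents, mubGram]
    simp only [Matrix.trace, Matrix.diag_apply, hdiag, Finset.sum_const, Finset.card_univ,
      nsmul_eq_mul, card_mubPoints hd hM]
    field_simp
  rw [ht] at h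
  exact_mod_cast h

/-- In `E 0 + E 4` the multiples of J cancel and C/(2d) remains. -/
theorem mem_qAntipodalClass_mubIdempotent (hd : 2 ≤ d) {x y : mubPoints M} :
    y ∈ qAntipodalClass (mubIdempotent M) x ↔ mubIdx x = mubIdx y := by
  have hd0 : d ≠ 0 := by omega
  have : (mubIdempotent M 0 + mubIdempotent M (Fin.last 4)) x y =
      (2 * d : ℝ)⁻¹ * if mubIdx x = mubIdx y then 1 else 0 := by
    simp [mubIdempotent, chainIdempotents, mubClassMatrix, Fin.last]
  rw [qAntipodalClass, Set.mem_ofPred_eq, this]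
  simp [hd0]

theorem numQAntipodalClasses_mubIdempotent (hd : 2 ≤ d) (hM : IsMUB M) :
    numQAntipodalClasses (mubIdempotent M) = f := by
  let pt : Fin f → mubPoints M := fun a => mubPoint M ((a, ⟨0, by omega⟩), false)
  have hpt : ∀ a, mubIdx (pt a) = a := fun a => mubIdx_mubPoint hd hM _
  have hrange : Set.range (qAntipodalClass (mubIdempotent M)) =
      Set.range fun a => qAntipodalClass (mubIdempotent M) (pt a) := by
    apply Set.Subset.antisymm
    · rintro _ ⟨x, rfl⟩
      refine ⟨mubIdx x, ?_⟩
      ext y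
      rw [mem_qAntipodalClass_mubIdempotent hd, mem_qAntipodalClass_mubIdempotent hd, hpt]
    · rintro _ ⟨a, rfl⟩
      exact ⟨pt a, rfl⟩
  have hinj : Function.Injective fun a => qAntipodalClass (mubIdempotent M) (pt a) := by
    intro a b hab
    have : pt b ∈ qAntipodalClass (mubIdempotent M) (pt a) := by
      rw [show qAntipodalClass (mubIdempotent M) (pt a) = _ from hab,
        mem_qAntipodalClass_mubIdempotent hd]
    rwa [mem_qAntipodalClass_mubIdempotent hd, hpt, hpt] at this
  rw [numQAntipodalClasses, hrange, ← Set.image_univ, Set.ncard_image_of_injective _ hinj]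
  simp

end MUBScheme

/-! ### Quadruple regularity forces f = d/2 + 1 -/

section MUBRegular

variable {d f : ℕ} {M : Fin f → OrthonormalBasis (Fin d) ℝ (EuclideanSpace ℝ (Fin d))}

/-- The number of points with prescribed inner products with four given points. -/
noncomputable def mubCount (i : Fin 4 → Fin 5) (x : Fin 4 → mubPoints M) : ℕ :=
  {w | ∀ k, mubRel M (i k) (x k) w}.ncard

open Classical in
theorem mubCount_eq_sum (i : Fin 4 → Fin 5) (x : Fin 4 → mubPoints M) :
    (mubCount i x : ℝ) =
      ∑ w, ∏ k, (if mubInner (x k) w = mubAngle d (i k) then (1 : ℝ) else 0) := by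
  rw [mubCount, Set.ncard_eq_toFinset_card']
  simp only [Finset.prod_ite_zero, Finset.prod_const_one]
  simp [mubRel_iff]

/-- Two quadruples of points in the same relations have the same Gram matrix. -/
theorem mubInner_eq_of_rel {j : Fin 4 → Fin 4 → Fin 5} {x y : Fin 4 → mubPoints M}
    (hx : ∀ k l, k < l → mubRel M (j k l) (x k) (x l))
    (hy : ∀ k l, k < l → mubRel M (j k l) (y k) (y l)) (k l : Fin 4) :
    mubInner (x k) (x l) = mubInner (y k) (y l) := by
  rcases lt_trichotomy k l with h | rfl | h
  · rw [mubRel_iff.mp (hx k l h), mubRel_iff.mp (hy k l h)]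
  · simp
  · rw [mubInner_comm, mubInner_comm (y k), mubRel_iff.mp (hx l k h), mubRel_iff.mp (hy l k h)]

/-- Quadruple regularity says that the counts depend only on the Gram matrix. -/
theorem isQuadruplyRegular_mubRel_iff (hd : 2 ≤ d) (hM : IsMUB M) :
    IsQuadruplyRegular (mubRel M) ↔ ∀ x y : Fin 4 → mubPoints M,
      (∀ k l, mubInner (x k) (x l) = mubInner (y k) (y l)) → ∀ i, mubCount i x = mubCount i y := by
  constructor
  · intro h x y hxy i
    choose j hj using fun k l => exists_mubInner_eq_mubAngle hd hM (x k) (x l)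
    obtain ⟨c, hc⟩ := h i j
    rw [mubCount, mubCount, hc x fun k l _ => hj k l,
      hc y fun k l _ => mubRel_iff.mpr ((hxy k l).symm.trans (hj k l))]
  · intro h i j
    by_cases hx : ∃ x : Fin 4 → mubPoints M, ∀ k l, k < l → mubRel M (j k l) (x k) (x l)
    · obtain ⟨x, hx⟩ := hx
      exact ⟨mubCount i x, fun y hy => h y x (mubInner_eq_of_rel hy hx) i⟩
    · exact ⟨0, fun x hx' => absurd ⟨x, hx'⟩ hx⟩

/-- The fourth mixed moment of `M ∪ (-M)` at four points. -/
noncomputable def mubMoment (x : Fin 4 → mubPoints M) : ℝ := ∑ w, ∏ k, mubInner (x k) w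

-- Sort the points w by their four angles. This is how quadruple regularity turns into information
-- about moments.
open Classical in
theorem mubMoment_eq_sum_mubCount (hd : 2 ≤ d) (hM : IsMUB M) (x : Fin 4 → mubPoints M) :
    mubMoment x = ∑ i : Fin 4 → Fin 5, (∏ k, mubAngle d (i k)) * mubCount i x := by
  have h : ∀ u w : mubPoints M, mubInner u w =
      ∑ m, mubAngle d m * if mubInner u w = mubAngle d m then 1 else 0 := by
    intro u w
    obtain ⟨m, hm⟩ := exists_mubInner_eq_mubAngle hd hM u w
    rw [Finset.sum_eq_single m]
    · simp [hm]
    · intro l _ hl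
      rw [if_neg, mul_zero]
      intro e
      exact hl (mubAngle_injective hd (e.symm.trans hm))
    · simp
  simp only [mubCount_eq_sum, Finset.mul_sum]
  rw [Finset.sum_comm, mubMoment]
  refine Finset.sum_congr rfl fun w _ => ?_
  simp only [← Finset.prod_mul_distrib]
  rw [← Fintype.prod_sum fun k m =>
    mubAngle d m * if mubInner (x k) w = mubAngle d m then (1 : ℝ) else 0]
  exact Finset.prod_congr rfl fun k _ => h (x k) w

/-- Under quadruple regularity the fourth moment vanishes as soon as one of the points is
orthogonal to the others. -/
theorem mubMoment_eq_zero (hd : 2 ≤ d) (hM : IsMUB M) (h : IsQuadruplyRegular (mubRel M))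
    (x : Fin 4 → mubPoints M) (m : Fin 4) (hm : ∀ k, k ≠ m → mubInner (x m) (x k) = 0) :
    mubMoment x = 0 := by
  -- Negating `x m` changes the sign only of inner products that are 0, so the Gram matrix and hence
  -- the moment stay the same. But the moment is linear in `x m`, so it also changes sign.
  have hx : mubMoment x = mubMoment (Function.update x m (mubNeg (x m))) := by
    rw [mubMoment_eq_sum_mubCount hd hM, mubMoment_eq_sum_mubCount hd hM]
    refine Finset.sum_congr rfl fun i _ => ?_
    congr 2
    refine (isQuadruplyRegular_mubRel_iff hd hM).mp h _ _ (fun k l => ?_) i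
    by_cases hk : k = m <;> by_cases hl : l = m
    · subst hk; subst hl; simp
    · subst hk; simp [hl, hm l hl]
    · subst hl; simp [hk, mubInner_comm (x k), hm k hk]
    · simp [hk, hl]
  have hneg : mubMoment (Function.update x m (mubNeg (x m))) = -mubMoment x := by
    unfold mubMoment
    rw [← Finset.sum_neg_distrib]
    refine Finset.sum_congr rfl fun w _ => ?_
    rw [← Finset.mul_prod_erase _ _ (Finset.mem_univ m),
      ← Finset.mul_prod_erase (a := m) _ (fun k => mubInner (x k) w) (Finset.mem_univ m),
      Function.update_self, mubInner_mubNeg_left, neg_mul]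
    congr 2
    refine Finset.prod_congr rfl fun k hk => ?_
    rw [Function.update_of_ne (Finset.ne_of_mem_erase hk)]
  linarith

theorem sum_class_of_ne (hd : 2 ≤ d) (hM : IsMUB M) {a : Fin f} {u : mubPoints M}
    (ha : a ≠ mubIdx u) (F : mubPoints M → ℝ) :
    ∑ w, (if mubIdx w = a then mubInner u w ^ 2 * F w else 0) =
      (1 / d : ℝ) * ∑ w, (if mubIdx w = a then F w else 0) := by
  rw [Finset.mul_sum]
  refine Finset.sum_congr rfl fun w _ => ?_
  split_ifs with h
  · rw [mubInner_sq_of_mubIdx_ne hd hM (by rw [h]; exact ha.symm)]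
  · simp

/-- A quadratic factor `⟨u, w⟩²` splits the sum into `±u` and the classes not containing `u`. -/
theorem sum_mubInner_sq_mul (hd : 2 ≤ d) (hM : IsMUB M) (u : mubPoints M)
    (F : mubPoints M → ℝ) :
    ∑ w, mubInner u w ^ 2 * F w =
      F u + F (mubNeg u) +
        (1 / d : ℝ) * ∑ a ∈ Finset.univ.erase (mubIdx u),
          ∑ w, (if mubIdx w = a then F w else 0) := by
  rw [sum_eq_sum_class, ← Finset.add_sum_erase _ _ (Finset.mem_univ (mubIdx u)), Finset.mul_sum]
  congr 1
  · have := sum_class_mubInner_mul hd hM u fun w => mubInner u w * F w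
    simp only [← mul_assoc, ← sq] at this
    rw [this]
    simp
  · exact Finset.sum_congr rfl fun a ha => sum_class_of_ne hd hM (Finset.ne_of_mem_erase ha) F

/-- Quadruple regularity forces the maximal number of bases. -/
theorem card_bases_of_isQuadruplyRegular (hd : 2 ≤ d) (hf : 2 ≤ f) (hM : IsMUB M)
    (h : IsQuadruplyRegular (mubRel M)) : (f : ℝ) = (d : ℝ) / 2 + 1 := by
  have hd0 : (d : ℝ) ≠ 0 := by exact_mod_cast (by omega : d ≠ 0)
  let a : Fin f := ⟨0, by omega⟩
  let b : Fin f := ⟨1, by omega⟩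
  let p : Fin d := ⟨0, by omega⟩
  let q : Fin d := ⟨1, by omega⟩
  have hpq : p ≠ q := by simp [p, q]
  let e : Fin d → mubPoints M := fun i => mubPoint M ((a, i), false)
  let w₀ : mubPoints M := mubPoint M ((b, p), false)
  have hee : ∀ i j, i ≠ j → mubInner (e i) (e j) = 0 := fun i j hij => by
    rw [mubInner_mubPoint_same, if_neg hij]
  have hidx : mubIdx w₀ = b := mubIdx_mubPoint hd hM _
  have hide : ∀ i, mubIdx (e i) = a := fun i => mubIdx_mubPoint hd hM _
  have hab : a ≠ b := by simp [a, b]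
  have hc : ∀ i, mubInner (e i) w₀ ≠ 0 := fun i h0 => by
    have := mubInner_sq_of_mubIdx_ne hd hM (x := e i) (y := w₀) (by rw [hidx, hide]; exact hab)
    rw [h0] at this
    field_simp at this
    norm_num at this
  have hexp : ∀ w, mubInner w₀ w = ∑ i, mubInner (e i) w₀ * mubInner (e i) w := fun w => by
    unfold mubInner
    rw [← (M a).sum_inner_mul_inner]
    refine Finset.sum_congr rfl fun i _ => ?_
    rw [real_inner_comm]
    simp [e, mubPoint]
  -- Direct evaluation: outside the class of `w₀` the square is 1/d, and the tight frame identity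
  -- yields a multiple of ⟨e_p, e_q⟩ = 0. Only ±`w₀` contribute.
  have hS₁ : ∑ w, mubInner w₀ w ^ 2 * (mubInner (e p) w * mubInner (e q) w) =
      2 * (mubInner (e p) w₀ * mubInner (e q) w₀) := by
    rw [sum_mubInner_sq_mul hd hM]
    simp only [sum_class_mul hd hM, hee p q hpq, mubInner_mubNeg_right]
    simp
    ring
  -- Unless {k, l} = {p, q}, one of the four basis vectors is orthogonal to the other three.
  have hF : ∀ k l, mubMoment ![e p, e q, e k, e l] =
      if (k = p ∧ l = q) ∨ (k = q ∧ l = p) then 2 * ((f : ℝ) - 1) / d else 0 := by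
    intro k l
    -- The basis of `e p` and `e q` contributes nothing by orthogonality; each of the other f - 1
    -- classes contributes 2d · (1/d)² = 2/d.
    have hmain : mubMoment ![e p, e q, e p, e q] = 2 * ((f : ℝ) - 1) / d := by
      have h1 : mubMoment ![e p, e q, e p, e q] =
          ∑ w, mubInner (e p) w ^ 2 * (mubInner (e q) w ^ 2 * 1) := by
        refine Finset.sum_congr rfl fun w _ => ?_
        simp [Fin.prod_univ_four]
        ring
      rw [h1, sum_mubInner_sq_mul hd hM]
      have h2 : ∀ a' ∈ Finset.univ.erase (mubIdx (e p)),
          ∑ w, (if mubIdx w = a' then mubInner (e q) w ^ 2 * 1 else 0) = 2 := by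
        intro a' ha'
        rw [sum_class_of_ne hd hM, sum_class_one hd hM]
        · field_simp
        · rw [hide] at ha' ⊢
          exact Finset.ne_of_mem_erase ha'
      rw [Finset.sum_congr rfl h2]
      simp only [mubInner_mubNeg_right, hee q p hpq.symm]
      rw [Finset.sum_const, Finset.card_erase_of_mem (Finset.mem_univ _), Finset.card_univ,
        Fintype.card_fin, nsmul_eq_mul, Nat.cast_sub (by omega)]
      push_cast
      ring
    have hzero : ∀ m,
        (∀ n, n ≠ m → mubInner (![e p, e q, e k, e l] m) (![e p, e q, e k, e l] n) = 0) →
        mubMoment ![e p, e q, e k, e l] = 0 :=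
      fun m hm => mubMoment_eq_zero hd hM h _ m hm
    by_cases hkl : k = l
    · subst hkl
      rw [if_neg (by rintro (⟨rfl, h⟩ | ⟨rfl, h⟩) <;> [exact hpq h; exact hpq h.symm])]
      by_cases hkp : k = p
      · subst hkp
        apply hzero 1
        intro n hn
        fin_cases n <;> simp at hn ⊢ <;> exact hee _ _ hpq.symm
      · apply hzero 0
        intro n hn
        fin_cases n <;> simp at hn ⊢ <;>
          first | exact hee _ _ hpq | exact hee _ _ (Ne.symm hkp)
    · by_cases hlp : l = p
      · subst hlp
        by_cases hkq : k = q
        · subst hkq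
          rw [if_pos (Or.inr ⟨rfl, rfl⟩), ← hmain]
          refine Finset.sum_congr rfl fun w _ => ?_
          simp [Fin.prod_univ_four]
          ring
        · rw [if_neg (by rintro (⟨h1, h2⟩ | ⟨h1, h2⟩) <;> contradiction)]
          apply hzero 2
          intro n hn
          fin_cases n <;> simp at hn ⊢ <;> first | exact hee _ _ hkl | exact hee _ _ hkq
      · by_cases hlq : l = q
        · subst hlq
          by_cases hkp : k = p
          · subst hkp
            rw [if_pos (Or.inl ⟨rfl, rfl⟩), hmain]
          · rw [if_neg (by rintro (⟨h1, h2⟩ | ⟨h1, h2⟩) <;> contradiction)]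
            apply hzero 2
            intro n hn
            fin_cases n <;> simp at hn ⊢ <;> first | exact hee _ _ hkp | exact hee _ _ hkl
        · rw [if_neg (by rintro (⟨h1, h2⟩ | ⟨h1, h2⟩) <;> contradiction)]
          apply hzero 3
          intro n hn
          fin_cases n <;> simp at hn ⊢ <;>
            first | exact hee _ _ hlp | exact hee _ _ hlq | exact hee _ _ (Ne.symm hkl)
  -- Second evaluation of the same sum: expand both factors ⟨w₀, w⟩ in the basis `e`.
  have hS₂ : ∑ w, mubInner w₀ w ^ 2 * (mubInner (e p) w * mubInner (e q) w) =
      ∑ k, ∑ l, mubInner (e k) w₀ * mubInner (e l) w₀ * mubMoment ![e p, e q, e k, e l] := by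
    simp only [mubMoment, Finset.mul_sum]
    rw [Finset.sum_comm_cycle]
    refine Finset.sum_congr rfl fun w _ => ?_
    rw [hexp w, sq, Finset.sum_mul_sum, Finset.sum_mul]
    refine Finset.sum_congr rfl fun k _ => ?_
    rw [Finset.sum_mul]
    refine Finset.sum_congr rfl fun l _ => ?_
    simp [Fin.prod_univ_four]
    ring
  have hS₃ : ∑ k, ∑ l, mubInner (e k) w₀ * mubInner (e l) w₀ * mubMoment ![e p, e q, e k, e l] =
      2 * (mubInner (e p) w₀ * mubInner (e q) w₀) * (2 * ((f : ℝ) - 1) / d) := by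
    have hsplit : ∀ k l, mubInner (e k) w₀ * mubInner (e l) w₀ * mubMoment ![e p, e q, e k, e l] =
        (if l = q then if k = p then mubInner (e k) w₀ * mubInner (e l) w₀ *
          (2 * ((f : ℝ) - 1) / d) else 0 else 0) +
        (if l = p then if k = q then mubInner (e k) w₀ * mubInner (e l) w₀ *
          (2 * ((f : ℝ) - 1) / d) else 0 else 0) := by
      intro k l
      rw [hF]
      by_cases h1 : k = p <;> by_cases h2 : k = q <;> by_cases h3 : l = p <;>
        by_cases h4 : l = q <;> simp_all
    simp only [hsplit, Finset.sum_add_distrib, Finset.sum_ite_eq', Finset.mem_univ, if_true]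
    ring
  have hfin := hS₁.symm.trans (hS₂.trans hS₃)
  have hne : 2 * (mubInner (e p) w₀ * mubInner (e q) w₀) ≠ 0 :=
    mul_ne_zero two_ne_zero (mul_ne_zero (hc p) (hc q))
  have h1 : 2 * ((f : ℝ) - 1) / d = 1 :=
    mul_left_cancel₀ hne (by rw [← hfin, mul_one])
  field_simp at h1
  linarith

end MUBRegular

/-! ### The fourth moment tensor of a maximal MUB -/

/-- The symmetric tensor `δ_{ij} δ_{kl} + δ_{ik} δ_{jl} + δ_{il} δ_{jk}`. -/
def pairingTensor {ι : Type*} [DecidableEq ι] (i j k l : ι) : ℝ :=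
  (if i = j then 1 else 0) * (if k = l then 1 else 0) +
  (if i = k then 1 else 0) * (if j = l then 1 else 0) +
  (if i = l then 1 else 0) * (if j = k then 1 else 0)

theorem sum_four_mul {ι : Type*} [Fintype ι] (a b c e : ι → ℝ) :
    ∑ i, ∑ j, ∑ k, ∑ l, a i * b j * c k * e l =
      (∑ i, a i) * (∑ i, b i) * (∑ i, c i) * ∑ i, e i := by
  simp only [← Finset.mul_sum, ← Finset.sum_mul]

/-- Summation over four indices commutes with summation over points. -/
theorem sum_four_comm {ι κ : Type*} [Fintype ι] [Fintype κ] (F : ι → ι → ι → ι → κ → ℝ) :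
    ∑ i, ∑ j, ∑ k, ∑ l, ∑ w, F i j k l w = ∑ w, ∑ i, ∑ j, ∑ k, ∑ l, F i j k l w :=
  (Finset.sum_congr rfl fun _ _ => (Finset.sum_congr rfl fun _ _ =>
    (Finset.sum_congr rfl fun _ _ => Finset.sum_comm).trans Finset.sum_comm).trans
      Finset.sum_comm).trans Finset.sum_comm

theorem sum_pairingTensor_mul {ι : Type*} [Fintype ι] [DecidableEq ι] (a b c e : ι → ℝ) :
    ∑ i, ∑ j, ∑ k, ∑ l, pairingTensor i j k l * (a i * b j * c k * e l) =
      (∑ i, a i * b i) * (∑ i, c i * e i) + (∑ i, a i * c i) * (∑ i, b i * e i) +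
      (∑ i, a i * e i) * (∑ i, b i * c i) := by
  simp only [pairingTensor, add_mul, Finset.sum_add_distrib, Finset.sum_mul_sum]
  congr 1
  · congr 1
    · simp only [ite_mul, one_mul, zero_mul, Finset.sum_ite_eq, Finset.mem_univ, if_true,
        Finset.sum_ite_irrel, Finset.sum_const_zero]
      refine Finset.sum_congr rfl fun i _ => Finset.sum_congr rfl fun k _ => by ring
    · simp only [ite_mul, one_mul, zero_mul, Finset.sum_ite_eq, Finset.mem_univ, if_true,
        Finset.sum_ite_irrel, Finset.sum_const_zero]
      refine Finset.sum_congr rfl fun i _ => Finset.sum_congr rfl fun k _ => by ring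
  · simp only [ite_mul, one_mul, zero_mul, Finset.sum_ite_eq, Finset.mem_univ, if_true]
    refine Finset.sum_congr rfl fun i _ => Finset.sum_congr rfl fun k _ => by ring

/-- Each of the three pairings has squared norm d², and each of the six ordered pairs of distinct
pairings has inner product d. -/
theorem sum_pairingTensor_sq (d : ℕ) :
    ∑ i : Fin d, ∑ j : Fin d, ∑ k : Fin d, ∑ l : Fin d, pairingTensor i j k l ^ 2 =
      3 * (d : ℝ) ^ 2 + 6 * d := by
  have h : ∀ i j k l : Fin d, pairingTensor i j k l ^ 2 =
      (if i = j then if k = l then pairingTensor i j k l else 0 else 0) +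
      (if i = k then if j = l then pairingTensor i j k l else 0 else 0) +
      (if j = k then if i = l then pairingTensor i j k l else 0 else 0) := by
    intro i j k l
    rw [sq]
    -- Only one factor is unfolded, so that its deltas contract the other.
    conv_lhs => enter [1]; unfold pairingTensor
    simp only [add_mul, ite_mul, one_mul, zero_mul]
    congr 1
    split_ifs <;> rfl
  simp only [h, Finset.sum_add_distrib, Finset.sum_ite_eq, Finset.mem_univ, if_true,
    Finset.sum_ite_irrel, Finset.sum_const_zero]
  simp only [pairingTensor, if_true, mul_one, Finset.sum_add_distrib]
  simp
  ring

section MUBMoment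

variable {d f : ℕ} {M : Fin f → OrthonormalBasis (Fin d) ℝ (EuclideanSpace ℝ (Fin d))}

theorem mubInner_eq_sum (x y : mubPoints M) :
    mubInner x y = ∑ i, (x : EuclideanSpace ℝ (Fin d)) i * (y : EuclideanSpace ℝ (Fin d)) i := by
  simp [mubInner, PiLp.inner_apply, mul_comm]

theorem mubInner_pow_four (x y : mubPoints M) :
    mubInner x y ^ 4 = ∑ i, ∑ j, ∑ k, ∑ l,
      ((x : EuclideanSpace ℝ (Fin d)) i * (x : EuclideanSpace ℝ (Fin d)) j *
        (x : EuclideanSpace ℝ (Fin d)) k * (x : EuclideanSpace ℝ (Fin d)) l) *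
      ((y : EuclideanSpace ℝ (Fin d)) i * (y : EuclideanSpace ℝ (Fin d)) j *
        (y : EuclideanSpace ℝ (Fin d)) k * (y : EuclideanSpace ℝ (Fin d)) l) := by
  rw [show mubInner x y ^ 4 = mubInner x y * mubInner x y * mubInner x y * mubInner x y by ring]
  simp only [mubInner_eq_sum]
  rw [← sum_four_mul]
  refine Finset.sum_congr rfl fun i _ => Finset.sum_congr rfl fun j _ =>
    Finset.sum_congr rfl fun k _ => Finset.sum_congr rfl fun l _ => by ring

/-- The points ±v give 2, and each of the f - 1 = d/2 other bases gives 2d · (1/d)² = 2/d. -/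
theorem sum_mubInner_pow_four (hd : 2 ≤ d) (hM : IsMUB M) (hfd : (f : ℝ) = (d : ℝ) / 2 + 1)
    (v : mubPoints M) : ∑ w, mubInner v w ^ 4 = 3 := by
  have hd0 : (d : ℝ) ≠ 0 := by exact_mod_cast (by omega : d ≠ 0)
  have hf : 1 ≤ f := Fin.pos (mubIdx v)
  have h := sum_mubInner_sq_mul hd hM v fun w => mubInner v w ^ 2 * 1
  have h2 : ∀ a ∈ Finset.univ.erase (mubIdx v),
      ∑ w, (if mubIdx w = a then mubInner v w ^ 2 * 1 else 0) = 2 := by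
    intro a ha
    rw [sum_class_of_ne hd hM (Finset.ne_of_mem_erase ha), sum_class_one hd hM]
    field_simp
  rw [Finset.sum_congr rfl h2, Finset.sum_const, Finset.card_erase_of_mem (Finset.mem_univ _),
    Finset.card_univ, Fintype.card_fin, nsmul_eq_mul, Nat.cast_sub hf, hfd] at h
  rw [show ∑ w, mubInner v w ^ 4 = ∑ w, mubInner v w ^ 2 * (mubInner v w ^ 2 * 1) from
    Finset.sum_congr rfl fun w _ => by ring, h]
  simp
  field_simp
  ring

/-- The fourth moment tensor of `M ∪ (-M)`. -/
noncomputable def mubTensor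
    (M : Fin f → OrthonormalBasis (Fin d) ℝ (EuclideanSpace ℝ (Fin d))) (i j k l : Fin d) : ℝ :=
  ∑ w : mubPoints M, (w : EuclideanSpace ℝ (Fin d)) i * (w : EuclideanSpace ℝ (Fin d)) j *
        (w : EuclideanSpace ℝ (Fin d)) k * (w : EuclideanSpace ℝ (Fin d)) l

/-- For the maximal number of bases the fourth moment tensor is the isotropic one. -/
theorem mubTensor_eq (hd : 2 ≤ d) (hM : IsMUB M) (hfd : (f : ℝ) = (d : ℝ) / 2 + 1)
    (i j k l : Fin d) : mubTensor M i j k l = pairingTensor i j k l := by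
  have hsq : ∑ i, ∑ j, ∑ k, ∑ l, mubTensor M i j k l ^ 2 = 3 * (2 * d * f : ℝ) := by
    rw [← card_mubPoints hd hM]
    calc ∑ i, ∑ j, ∑ k, ∑ l, mubTensor M i j k l ^ 2
        = ∑ v : mubPoints M, ∑ w, mubInner v w ^ 4 := by
          simp only [sq, mubTensor, Finset.sum_mul_sum, mubInner_pow_four]
          rw [sum_four_comm]
          refine Finset.sum_congr rfl fun v _ => ?_
          rw [sum_four_comm]
      _ = _ := by
          simp only [sum_mubInner_pow_four hd hM hfd, Finset.sum_const, Finset.card_univ,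
            nsmul_eq_mul]
          ring
  have hmix : ∑ i, ∑ j, ∑ k, ∑ l, pairingTensor i j k l * mubTensor M i j k l =
      3 * (2 * d * f : ℝ) := by
    rw [← card_mubPoints hd hM]
    simp only [mubTensor, Finset.mul_sum]
    rw [sum_four_comm]
    simp only [sum_pairingTensor_mul, ← mubInner_eq_sum, mubInner_self]
    simp only [Finset.sum_const, Finset.card_univ, nsmul_eq_mul]
    ring
  -- With N = 2df points, the squared distance is 3N - 2 · 3N + 3d(d + 2), and f = d/2 + 1 says
  -- exactly that N = d(d + 2).
  have hzero : ∑ i, ∑ j, ∑ k, ∑ l, (mubTensor M i j k l - pairingTensor i j k l) ^ 2 = 0 := by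
    have : ∀ i j k l, (mubTensor M i j k l - pairingTensor i j k l) ^ 2 =
        mubTensor M i j k l ^ 2 - 2 * (pairingTensor i j k l * mubTensor M i j k l) +
          pairingTensor i j k l ^ 2 := fun i j k l => by ring
    simp only [this, Finset.sum_add_distrib, Finset.sum_sub_distrib, ← Finset.mul_sum, hsq, hmix,
      sum_pairingTensor_sq, hfd]
    ring
  have hnn : ∀ i j k l, 0 ≤ (mubTensor M i j k l - pairingTensor i j k l) ^ 2 :=
    fun i j k l => sq_nonneg _
  rw [Finset.sum_eq_zero_iff_of_nonneg fun i _ => Finset.sum_nonneg fun j _ =>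
    Finset.sum_nonneg fun k _ => Finset.sum_nonneg fun l _ => hnn i j k l] at hzero
  have h1 := hzero i (Finset.mem_univ i)
  rw [Finset.sum_eq_zero_iff_of_nonneg fun j _ =>
    Finset.sum_nonneg fun k _ => Finset.sum_nonneg fun l _ => hnn i j k l] at h1
  have h2 := h1 j (Finset.mem_univ j)
  rw [Finset.sum_eq_zero_iff_of_nonneg fun k _ => Finset.sum_nonneg fun l _ => hnn i j k l] at h2
  have h3 := h2 k (Finset.mem_univ k)
  rw [Finset.sum_eq_zero_iff_of_nonneg fun l _ => hnn i j k l] at h3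
  exact sub_eq_zero.mp (pow_eq_zero_iff two_ne_zero |>.mp (h3 l (Finset.mem_univ l)))

/-- Contract the tensor identity with the four vectors. -/
theorem mubMoment_eq (hd : 2 ≤ d) (hM : IsMUB M) (hfd : (f : ℝ) = (d : ℝ) / 2 + 1)
    (x : Fin 4 → mubPoints M) :
    mubMoment x = mubInner (x 0) (x 1) * mubInner (x 2) (x 3) +
      mubInner (x 0) (x 2) * mubInner (x 1) (x 3) +
      mubInner (x 0) (x 3) * mubInner (x 1) (x 2) := by
  simp only [mubInner_eq_sum]
  rw [← sum_pairingTensor_mul]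
  simp only [← mubTensor_eq hd hM hfd, mubTensor, Finset.sum_mul]
  rw [sum_four_comm]
  refine Finset.sum_congr rfl fun w _ => ?_
  simp only [Fin.prod_univ_four, mubInner_eq_sum]
  rw [← sum_four_mul]
  refine Finset.sum_congr rfl fun i _ => Finset.sum_congr rfl fun j _ =>
    Finset.sum_congr rfl fun k _ => Finset.sum_congr rfl fun l _ => by ring

end MUBMoment

/-! ### A maximal MUB is quadruply regular -/

section MUBSufficient

variable {d f : ℕ} {M : Fin f → OrthonormalBasis (Fin d) ℝ (EuclideanSpace ℝ (Fin d))}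

open Classical in
/-- A basis of the functions on the set of angles: `1`, `t`, and the indicator functions of
`{0, 1, -1}`, `{1}` and `{-1}`. -/
noncomputable def angleBasis (m : Fin 5) (t : ℝ) : ℝ :=
  ![1, t, if t = 0 ∨ t = 1 ∨ t = -1 then 1 else 0, if t = 1 then 1 else 0,
    if t = -1 then 1 else 0] m

/-- The coefficients of the indicator functions of the angles with respect to `angleBasis`. -/
noncomputable def angleCoeff (d : ℕ) : Fin 5 → Fin 5 → ℝ :=
  ![![0, 0, 0, 1, 0],
    ![1 / 2, √(d : ℝ) / 2, -1 / 2, -√(d : ℝ) / 2, √(d : ℝ) / 2],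
    ![0, 0, 1, -1, -1],
    ![1 / 2, -√(d : ℝ) / 2, -1 / 2, √(d : ℝ) / 2, -√(d : ℝ) / 2],
    ![0, 0, 0, 0, 1]]

-- A finite check over pairs of angles. For ±1/√d, half of 1 minus the indicator of {0, 1, -1}
-- detects |t| = 1/√d, and the odd function t - [t = 1] + [t = -1], scaled by √d/2, separates the
-- signs.
open Classical in
theorem indicator_mubAngle_eq (hd : 2 ≤ d) (i k : Fin 5) :
    (if mubAngle d k = mubAngle d i then (1 : ℝ) else 0) =
      ∑ m, angleCoeff d i m * angleBasis m (mubAngle d k) := by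
  have h0 := inv_sqrt_pos hd
  have h1 := inv_sqrt_lt_one hd
  have hs : 1 / √(d : ℝ) * √(d : ℝ) = 1 := by
    have : √(d : ℝ) ≠ 0 := fun h => by simp [h] at h0
    field_simp
  simp only [(mubAngle_injective hd).eq_iff]
  have e0 : mubAngle d 0 = 1 := rfl
  have e1 : mubAngle d 1 = 1 / √(d : ℝ) := rfl
  have e2 : mubAngle d 2 = 0 := rfl
  have e3 : mubAngle d 3 = -(1 / √(d : ℝ)) := rfl
  have e4 : mubAngle d 4 = -1 := rfl
  generalize 1 / √(d : ℝ) = s at *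
  have hm : (-1 : ℝ) ≠ 1 := by norm_num
  have n0 : s ≠ 0 := h0.ne'
  have n1 : s ≠ 1 := h1.ne
  have n2 : s ≠ -1 := by linarith
  have n3 : -s ≠ 1 := by linarith
  rw [Fin.sum_univ_five]
  fin_cases k <;> simp only [Fin.zero_eta, Fin.mk_one, Fin.reduceFinMk, e0, e1, e2, e3, e4] <;>
    fin_cases i <;> simp [angleCoeff, angleBasis, hm, hm.symm, n0, n1, n2, n3] <;> linarith

theorem prod_mubInner_neg (x : Fin 4 → mubPoints M) (S : Finset (Fin 4)) (w : mubPoints M) :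
    ∏ l ∈ S, mubInner (x l) (mubNeg w) = (-1) ^ S.card * ∏ l ∈ S, mubInner (x l) w := by
  simp only [mubInner_mubNeg_right]
  exact Finset.prod_neg _

/-- Mixed moments of degree at most three over a class depend only on the Gram matrix. -/
theorem sum_class_prod_eq (hd : 2 ≤ d) (hM : IsMUB M) {x y : Fin 4 → mubPoints M}
    (h : ∀ k l, mubInner (x k) (x l) = mubInner (y k) (y l)) (a b : Fin f) {S : Finset (Fin 4)}
    (hS : S.card ≤ 3) :
    ∑ w, (if mubIdx w = a then ∏ l ∈ S, mubInner (x l) w else 0) =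
      ∑ w, (if mubIdx w = b then ∏ l ∈ S, mubInner (y l) w else 0) := by
  -- Antipodality kills degrees 1 and 3. Degree 0 gives 2d and degree 2 the tight frame value,
  -- neither depending on the class, so `a` and `b` may differ.
  have hodd : Odd S.card → ∀ (a : Fin f) (x : Fin 4 → mubPoints M),
      ∑ w, (if mubIdx w = a then ∏ l ∈ S, mubInner (x l) w else 0) = 0 := fun ho a x =>
    sum_class_odd hd hM a _ fun w => by rw [prod_mubInner_neg, ho.neg_one_pow, neg_one_mul]
  rcases Nat.even_or_odd S.card with he | ho
  · have : S.card = 0 ∨ S.card = 2 := by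
      obtain ⟨r, hr⟩ := he
      omega
    rcases this with h0 | h2
    · rw [Finset.card_eq_zero] at h0
      simp only [h0, Finset.prod_empty, sum_class_one hd hM]
    · obtain ⟨k, l, hkl, rfl⟩ := Finset.card_eq_two.mp h2
      simp only [Finset.prod_pair hkl, sum_class_mul hd hM, h k l]
  · rw [hodd ho, hodd ho]

theorem sum_prod_eq (hd : 2 ≤ d) (hM : IsMUB M) (hfd : (f : ℝ) = (d : ℝ) / 2 + 1)
    {x y : Fin 4 → mubPoints M}
    (h : ∀ k l, mubInner (x k) (x l) = mubInner (y k) (y l)) (S : Finset (Fin 4)) :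
    ∑ w, ∏ l ∈ S, mubInner (x l) w = ∑ w, ∏ l ∈ S, mubInner (y l) w := by
  by_cases hS : S = Finset.univ
  · subst hS
    change mubMoment x = mubMoment y
    simp only [mubMoment_eq hd hM hfd, h]
  · have : S.card < 4 := by
      have := Finset.card_lt_card (Finset.ssubset_univ_iff.mpr hS)
      simpa using this
    rw [sum_eq_sum_class, sum_eq_sum_class (fun w => ∏ l ∈ S, mubInner (y l) w)]
    exact Finset.sum_congr rfl fun a _ => sum_class_prod_eq hd hM h a a (by omega)

/-- A factor [t = 1] or [t = -1] reduces the sum to the single point ±`x k`. Otherwise a class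
indicator confines w to the class of `x k` and leaves at most three linear factors, for which
moments over one class suffice. With linear factors only, the sum runs over all points; the product
of four of them is where f = d/2 + 1 enters. -/
theorem sum_prod_angleBasis_eq (hd : 2 ≤ d) (hM : IsMUB M) (hfd : (f : ℝ) = (d : ℝ) / 2 + 1)
    {x y : Fin 4 → mubPoints M}
    (h : ∀ k l, mubInner (x k) (x l) = mubInner (y k) (y l)) (p : Fin 4 → Fin 5) :
    ∑ w, ∏ k, angleBasis (p k) (mubInner (x k) w) =
      ∑ w, ∏ k, angleBasis (p k) (mubInner (y k) w) := by
  classical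
  by_cases h3 : ∃ k, p k = 3
  · obtain ⟨k, hk⟩ := h3
    have key : ∀ x : Fin 4 → mubPoints M, ∑ w, ∏ l, angleBasis (p l) (mubInner (x l) w) =
        ∏ l, angleBasis (p l) (mubInner (x l) (x k)) := by
      intro x
      refine Finset.sum_eq_single (x k) (fun w _ hw => ?_) (by simp)
      refine Finset.prod_eq_zero (Finset.mem_univ k) ?_
      simp [hk, angleBasis, mubInner_eq_one_iff, hw.symm]
    simp only [key, h]
  by_cases h4 : ∃ k, p k = 4
  · obtain ⟨k, hk⟩ := h4
    have key : ∀ x : Fin 4 → mubPoints M, ∑ w, ∏ l, angleBasis (p l) (mubInner (x l) w) =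
        ∏ l, angleBasis (p l) (-mubInner (x l) (x k)) := by
      intro x
      simp only [← mubInner_mubNeg_right]
      refine Finset.sum_eq_single (mubNeg (x k)) (fun w _ hw => ?_) (by simp)
      refine Finset.prod_eq_zero (Finset.mem_univ k) ?_
      have : x k ≠ mubNeg w := fun e => hw (by rw [e, mubNeg_mubNeg])
      simp [hk, angleBasis, mubInner_eq_neg_one_iff, this]
    simp only [key, h]
  let S : Finset (Fin 4) := Finset.univ.filter fun l => p l = 1
  by_cases h2 : ∃ k, p k = 2
  · obtain ⟨k, hk⟩ := h2
    have hS : S.card ≤ 3 := by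
      have := Finset.card_lt_univ_of_notMem (s := S) (x := k) (by simp [S, hk])
      simp at this
      omega
    have key : ∀ x : Fin 4 → mubPoints M, ∑ w, ∏ l, angleBasis (p l) (mubInner (x l) w) =
        (∏ l, if p l = 2 then angleBasis 2 (mubInner (x l) (x k)) else 1) *
          ∑ w, (if mubIdx w = mubIdx (x k) then ∏ l ∈ S, mubInner (x l) w else 0) := by
      intro x
      rw [Finset.mul_sum]
      refine Finset.sum_congr rfl fun w _ => ?_
      split_ifs with hw
      · rw [Finset.prod_filter, ← Finset.prod_mul_distrib]
        refine Finset.prod_congr rfl fun l _ => ?_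
        -- On the class of `x k` the other class indicators are constant and can be pulled out of
        -- the sum.
        have hcls : angleBasis 2 (mubInner (x l) w) = angleBasis 2 (mubInner (x l) (x k)) := by
          simp [angleBasis, ← mubIdx_eq_iff hd hM, hw]
        have n3 : p l ≠ 3 := fun e => h3 ⟨l, e⟩
        have n4 : p l ≠ 4 := fun e => h4 ⟨l, e⟩
        generalize p l = m at *
        fin_cases m <;> simp_all [angleBasis]
      · rw [mul_zero]
        refine Finset.prod_eq_zero (Finset.mem_univ k) ?_
        simp [hk, angleBasis, ← mubIdx_eq_iff hd hM, Ne.symm hw]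
    rw [key, key, sum_class_prod_eq hd hM h (mubIdx (x k)) (mubIdx (y k)) hS]
    simp only [h]
  · have key : ∀ x : Fin 4 → mubPoints M, ∑ w, ∏ l, angleBasis (p l) (mubInner (x l) w) =
        ∑ w, ∏ l ∈ S, mubInner (x l) w := by
      intro x
      refine Finset.sum_congr rfl fun w _ => ?_
      rw [Finset.prod_filter]
      refine Finset.prod_congr rfl fun l _ => ?_
      have n2 : p l ≠ 2 := fun e => h2 ⟨l, e⟩
      have n3 : p l ≠ 3 := fun e => h3 ⟨l, e⟩
      have n4 : p l ≠ 4 := fun e => h4 ⟨l, e⟩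
      generalize p l = m at *
      fin_cases m <;> simp_all [angleBasis]
    rw [key, key, sum_prod_eq hd hM hfd h]

/-- For the maximal number of bases the scheme is quadruply regular. -/
theorem isQuadruplyRegular_of_card_bases (hd : 2 ≤ d) (hM : IsMUB M)
    (hfd : (f : ℝ) = (d : ℝ) / 2 + 1) : IsQuadruplyRegular (mubRel M) := by
  classical
  rw [isQuadruplyRegular_mubRel_iff hd hM]
  intro x y h i
  have key : ∀ x : Fin 4 → mubPoints M, (mubCount i x : ℝ) = ∑ p : Fin 4 → Fin 5,
      (∏ k, angleCoeff d (i k) (p k)) * ∑ w, ∏ k, angleBasis (p k) (mubInner (x k) w) := by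
    intro x
    rw [mubCount_eq_sum]
    simp only [Finset.mul_sum]
    rw [Finset.sum_comm]
    refine Finset.sum_congr rfl fun w _ => ?_
    simp only [← Finset.prod_mul_distrib]
    rw [← Fintype.prod_sum fun k m => angleCoeff d (i k) m * angleBasis m (mubInner (x k) w)]
    refine Finset.prod_congr rfl fun k _ => ?_
    obtain ⟨m, hm⟩ := exists_mubInner_eq_mubAngle hd hM (x k) w
    rw [hm]
    exact indicator_mubAngle_eq hd (i k) m
  have : (mubCount i x : ℝ) = mubCount i y := by
    simp only [key, sum_prod_angleBasis_eq hd hM hfd h]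
  exact_mod_cast this

theorem isQuadruplyRegular_mubRel_iff_card_bases (hd : 2 ≤ d) (hf : 2 ≤ f) (hM : IsMUB M) :
    IsQuadruplyRegular (mubRel M) ↔ (f : ℝ) = (d : ℝ) / 2 + 1 :=
  ⟨card_bases_of_isQuadruplyRegular hd hf hM, isQuadruplyRegular_of_card_bases hd hM⟩

end MUBSufficient

/-! ### Idempotents and Krein numbers of an abstract scheme -/

section Scheme

variable {X : Type*} [Fintype X] {n : ℕ}
  {R : Fin (n + 1) → X → X → Prop} {E : Fin (n + 1) → Matrix X X ℝ}

theorem IsSymmetricAssociationScheme.card_ne_zero (hR : IsSymmetricAssociationScheme R) :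
    (Fintype.card X : ℝ) ≠ 0 := by
  obtain ⟨x, _⟩ := hR.rel_nonempty 0
  exact_mod_cast (Fintype.card_pos_iff.mpr ⟨x⟩).ne'

variable [DecidableEq X]

theorem IsPrimitiveIdempotentOrdering.apply_comm (hR : IsSymmetricAssociationScheme R)
    (hE : IsPrimitiveIdempotentOrdering R E) (i : Fin (n + 1)) (x y : X) : E i x y = E i y x := by
  obtain ⟨k, hk, _⟩ := hR.rel_partition x y
  exact boseMesner_apply_eq hR.rel_partition (hE.mem_boseMesner i) hk (hR.rel_symm k x y hk)

theorem IsPrimitiveIdempotentOrdering.card_mul_diag (hR : IsSymmetricAssociationScheme R)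
    (hE : IsPrimitiveIdempotentOrdering R E) (i : Fin (n + 1)) (x : X) :
    Fintype.card X * E i x x = (E i).trace := by
  have h : ∀ y, E i y y = E i x x := fun y =>
    boseMesner_apply_eq hR.rel_partition (hE.mem_boseMesner i)
      ((hR.rel_zero_iff y y).mpr rfl) ((hR.rel_zero_iff x x).mpr rfl)
  simp [Matrix.trace, h]

theorem IsPrimitiveIdempotentOrdering.trace_ne_zero (hE : IsPrimitiveIdempotentOrdering R E)
    (i : Fin (n + 1)) : (E i).trace ≠ 0 := by
  have hidem : IsIdempotentElem (Matrix.toLin' (E i)) := by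
    rw [IsIdempotentElem, Module.End.mul_eq_comp, ← Matrix.toLin'_mul, hE.idem i]
  rw [← Matrix.trace_toLin'_eq, Ne, LinearMap.IsIdempotentElem.trace_eq_zero_iff hidem,
    LinearEquiv.map_eq_zero_iff]
  exact hE.ne_zero i

/-- Two pairs at which all primitive idempotents agree lie in the same relation. -/
theorem IsPrimitiveIdempotentOrdering.rel_of_apply_eq
    (hE : IsPrimitiveIdempotentOrdering R E) {x y x' y' : X}
    (h : ∀ i, E i x y = E i x' y') {k : Fin (n + 1)} (hk : R k x y) : R k x' y' := by
  have hspan := span_range_idempotent_eq hE.mem_boseMesner hE.idem hE.orth hE.ne_zero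
  have hmem : adjacency R k ∈ Submodule.span ℝ (Set.range E) := by
    rw [hspan]
    exact Submodule.subset_span ⟨k, rfl⟩
  obtain ⟨c, hc⟩ := (Submodule.mem_span_range_iff_exists_fun ℝ).mp hmem
  have heq : adjacency R k x y = adjacency R k x' y' := by
    simp [← hc, Matrix.sum_apply, h]
  by_contra hk'
  simp [adjacency, hk, hk'] at heq

theorem IsPrimitiveIdempotentOrdering.kreinNumber_zero_right
    (hR : IsSymmetricAssociationScheme R) (hE : IsPrimitiveIdempotentOrdering R E)
    (i k : Fin (n + 1)) : kreinNumber E i 0 k = if k = i then 1 else 0 := by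
  have h : E i ⊙ E 0 =
      ∑ l, (if l = i then (Fintype.card X : ℝ)⁻¹ else 0) • E l := by
    ext x y
    simp [hE.zero_eq, mul_comm]
  rw [kreinNumber_eq_of_hadamard_eq hE.idem hE.orth h (hE.trace_ne_zero k)]
  split_ifs
  · rw [mul_inv_cancel₀ hR.card_ne_zero]
  · simp

/-- The column sums of the matrix of Krein numbers. -/
theorem IsPrimitiveIdempotentOrdering.sum_kreinNumber
    (hR : IsSymmetricAssociationScheme R) (hE : IsPrimitiveIdempotentOrdering R E)
    (i k : Fin (n + 1)) : ∑ j, kreinNumber E i j k = (E i).trace := by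
  have hN := hR.card_ne_zero
  -- The `E j` sum to the identity matrix, so only the diagonal of `E i` remains, and it is
  -- constant.
  have h1 : ∑ j, E i ⊙ E j = ((Fintype.card X : ℝ)⁻¹ * (E i).trace) • (1 : Matrix X X ℝ) := by
    rw [← hE.sum_eq_one]
    ext x y
    simp only [Matrix.sum_apply, Matrix.hadamard_apply, ← Finset.mul_sum, Matrix.smul_apply]
    rw [← Matrix.sum_apply, hE.sum_eq_one]
    by_cases hxy : x = y
    · subst hxy
      rw [← hE.card_mul_diag hR i x]
      simp [hN]
    · simp [hxy]
  have h2 : ∑ j, ((E i ⊙ E j) * E k).trace =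
      (Fintype.card X : ℝ)⁻¹ * (E i).trace * (E k).trace := by
    rw [← Matrix.trace_sum, ← Finset.sum_mul, h1, Matrix.smul_mul, one_mul, Matrix.trace_smul,
      smul_eq_mul]
  simp only [kreinNumber, mul_div_assoc]
  rw [← Finset.mul_sum, ← Finset.sum_div, h2]
  have := hE.trace_ne_zero k
  field_simp

end Scheme

/-! ### The dual recurrences and their solutions -/

/-- The dual recurrences of a 4-class `Q`-polynomial scheme that is `Q`-antipodal and
`Q`-bipartite, in terms of the scaled entries `N E_j(x, y)` with `d = rank E_1`, `c = c_2^*`. -/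
structure DualRecurrence {X : Type*} [Fintype X] (E : Fin 5 → Matrix X X ℝ) (d c : ℝ) : Prop where
  c_ne_zero : c ≠ 0
  d_ne_zero : d ≠ 0
  d_ne_one : d ≠ 1
  d_ne_c : d ≠ c
  zero : ∀ x y, Fintype.card X * E 0 x y = 1
  one : ∀ x y, (Fintype.card X * E 1 x y) * (Fintype.card X * E 1 x y) =
    d + c * (Fintype.card X * E 2 x y)
  two : ∀ x y, (Fintype.card X * E 1 x y) * (Fintype.card X * E 2 x y) =
    (d - 1) * (Fintype.card X * E 1 x y) + (d - 1) * (Fintype.card X * E 3 x y)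
  three : ∀ x y, (Fintype.card X * E 1 x y) * (Fintype.card X * E 3 x y) =
    (d - c) * (Fintype.card X * E 2 x y) + d * (Fintype.card X * E 4 x y)
  four : ∀ x y, (Fintype.card X * E 1 x y) * (Fintype.card X * E 4 x y) =
    Fintype.card X * E 3 x y

theorem exists_dualRecurrence {X : Type*} [Fintype X] [DecidableEq X]
    {R : Fin 5 → X → X → Prop} {E : Fin 5 → Matrix X X ℝ}
    (hR : IsSymmetricAssociationScheme R) (hE : IsPrimitiveIdempotentOrdering R E)
    (hQ : IsQPolynomial E) (hA : IsQAntipodal E) (hB : IsQBipartite E) :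
    ∃ c, DualRecurrence E (E 1).rank c := by
  have hN := hR.card_ne_zero
  have hd : ((E 1).rank : ℝ) = (E 1).trace := Matrix.rank_eq_trace_of_idempotent (hE.idem 1)
  have hcol := hE.sum_kreinNumber hR 1
  have hq0 := hE.kreinNumber_zero_right hR 1
  rw [← hd] at hcol
  have hd0 : ((E 1).rank : ℝ) ≠ 0 := by rw [hd]; exact hE.trace_ne_zero 1
  generalize ((E 1).rank : ℝ) = d at *
  have hrec : ∀ (j : Fin 5) (x y : X), (Fintype.card X * E 1 x y) * (Fintype.card X * E j x y) =
      ∑ k, kreinNumber E 1 j k * (Fintype.card X * E k x y) := by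
    intro j x y
    have h := congrFun (congrFun (hadamard_eq_sum_kreinNumber hR hE 1 j) x) y
    simp only [Matrix.hadamard_apply, Matrix.smul_apply, Matrix.sum_apply, smul_eq_mul] at h
    rw [mul_mul_mul_comm, h, mul_assoc, mul_inv_cancel_left₀ hN, Finset.mul_sum]
    exact Finset.sum_congr rfl fun k _ => by ring
  have z : ∀ j k : Fin 5, (j : ℕ) + 1 < k ∨ (k : ℕ) + 1 < j → kreinNumber E 1 j k = 0 :=
    fun j k => (hQ j k).1
  have nz : ∀ j k : Fin 5, (j : ℕ) + 1 = k ∨ (k : ℕ) + 1 = j → kreinNumber E 1 j k ≠ 0 :=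
    fun j k => (hQ j k).2
  have diag : ∀ j, kreinNumber E 1 j j = 0 := hB
  have z02 := z 0 2 (by simp); have z03 := z 0 3 (by simp); have z04 := z 0 4 (by simp)
  have z13 := z 1 3 (by simp); have z14 := z 1 4 (by simp); have z24 := z 2 4 (by simp)
  have z20 := z 2 0 (by simp); have z30 := z 3 0 (by simp); have z40 := z 4 0 (by simp)
  have z31 := z 3 1 (by simp); have z41 := z 4 1 (by simp); have z42 := z 4 2 (by simp)
  have d0 := diag 0; have d1 := diag 1; have d2 := diag 2; have d3 := diag 3; have d4 := diag 4
  have c0 := hcol 0; have c1 := hcol 1; have c2 := hcol 2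
  have q01 : kreinNumber E 1 0 1 = 1 := by rw [hq0]; simp
  rw [Fin.sum_univ_five] at c0 c1 c2
  -- Antipodality is used at j = 0, 1, 3; the exempt index is 2. Together with the column sums d it
  -- leaves only `q_{11}^2` free.
  have a0 : kreinNumber E 1 1 0 = kreinNumber E 1 3 4 := hA 0 (by simp)
  have a1 : kreinNumber E 1 2 1 = kreinNumber E 1 2 3 := hA 1 (by simp)
  have a3 : kreinNumber E 1 4 3 = kreinNumber E 1 0 1 := hA 3 (by simp)
  have q10 : kreinNumber E 1 1 0 = d := by linarith
  have q21 : kreinNumber E 1 2 1 = d - 1 := by linarith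
  have q32 : kreinNumber E 1 3 2 = d - kreinNumber E 1 1 2 := by linarith
  have q34 : kreinNumber E 1 3 4 = d := by linarith
  have q23 : kreinNumber E 1 2 3 = d - 1 := by linarith
  have q43 : kreinNumber E 1 4 3 = 1 := by linarith
  have v0 : ∀ x y, Fintype.card X * E 0 x y = 1 := fun x y => by
    rw [hE.zero_eq, Matrix.of_apply, mul_inv_cancel₀ hN]
  -- The values d = 1 and d = c are excluded because `q_{12}^1 = d - 1` and `q_{13}^2 = d - c` must
  -- not vanish.
  refine ⟨kreinNumber E 1 1 2, nz 1 2 (by simp), hd0, fun h => nz 2 1 (by simp) ?_,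
    fun h => nz 3 2 (by simp) ?_, v0, fun x y => ?_, fun x y => ?_, fun x y => ?_,
    fun x y => ?_⟩
  · rw [q21, h, sub_self]
  · rw [q32, ← h, sub_self]
  · rw [hrec, Fin.sum_univ_five, q10, d1, z13, z14, v0]; ring
  · rw [hrec, Fin.sum_univ_five, q21, q23, z20, d2, z24]; ring
  · rw [hrec, Fin.sum_univ_five, z30, z31, q32, d3, q34]; ring
  · rw [hrec, Fin.sum_univ_five, z40, z41, z42, q43, d4]; ring

theorem dual_recurrence_cases {d c u v₂ v₃ v₄ : ℝ} (hc : c ≠ 0) (hd : d ≠ 0) (hd1 : d ≠ 1)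
    (h1 : u * u = d + c * v₂) (h2 : u * v₂ = (d - 1) * u + (d - 1) * v₃)
    (h3 : u * v₃ = (d - c) * v₂ + d * v₄) (h4 : u * v₄ = v₃) :
    (u = 0 ∧ v₂ = -(d / c) ∧ v₄ = d / c - 1) ∨ (u ^ 2 = d ∧ v₂ = 0 ∧ v₄ = -1) ∨
      (u ^ 2 = d ^ 2 ∧ v₂ = (d - 1) * (d / c) ∧ v₄ = d / c - 1) := by
  have hd1' : d - 1 ≠ 0 := sub_ne_zero.mpr hd1
  subst h4
  by_cases hu : u = 0
  · subst hu
    left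
    have hv2 : v₂ = -(d / c) := by field_simp; linarith
    refine ⟨rfl, hv2, ?_⟩
    rw [hv2] at h3
    have hcd : c * (d / c) = d := by field_simp
    apply mul_left_cancel₀ hd
    linear_combination -h3 - hcd
  · right
    have hv2 : v₂ = (d - 1) * (1 + v₄) := mul_left_cancel₀ hu (by linarith)
    -- Multiplying the first relation by v₄ and comparing with the third gives v₂ (c v₄ - (d - c)) =
    -- 0, and v₂ is a nonzero multiple of 1 + v₄.
    have hprod : (1 + v₄) * (c * v₄ - (d - c)) = 0 := by
      apply mul_left_cancel₀ hd1'
      rw [hv2] at h1 h3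
      linear_combination h3 - v₄ * h1
    rcases mul_eq_zero.mp hprod with h | h
    · left
      have hv2' : v₂ = 0 := by rw [hv2, h, mul_zero]
      refine ⟨?_, hv2', by linarith⟩
      rw [sq, h1, hv2']; ring
    · right
      have hv4 : v₄ = d / c - 1 := by field_simp; linarith
      have hv2' : v₂ = (d - 1) * (d / c) := by rw [hv2, hv4]; ring
      refine ⟨?_, hv2', hv4⟩
      rw [sq, h1, hv2']
      field_simp
      ring

/-! ### Gram vectors of a projection, and orthonormal bases up to sign -/

/-- A symmetric idempotent matrix of rank `d` is a Gram matrix of vectors in `ℝ^d`. -/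
theorem Matrix.exists_gram_of_idempotent {X : Type*} [Fintype X] [DecidableEq X] {d : ℕ}
    {P : Matrix X X ℝ} (hsymm : ∀ x y, P x y = P y x) (hidem : P * P = P) (hrank : P.rank = d) :
    ∃ ψ : X → EuclideanSpace ℝ (Fin d), ∀ x y, inner ℝ (ψ x) (ψ y) = P x y := by
  -- The vectors are the columns of `P`: their inner products are the entries of P² = P, and they
  -- span a space of dimension d, in which orthonormal coordinates are taken.
  let e : (X → ℝ) ≃ₗ[ℝ] EuclideanSpace ℝ X := (WithLp.linearEquiv 2 ℝ (X → ℝ)).symm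
  let V : Submodule ℝ (EuclideanSpace ℝ X) :=
    (Submodule.span ℝ (Set.range P.col)).map (e : (X → ℝ) →ₗ[ℝ] EuclideanSpace ℝ X)
  have hV : Module.finrank ℝ V = d := by
    rw [← hrank, Matrix.rank_eq_finrank_span_cols]
    exact LinearEquiv.finrank_map_eq e _
  have hmem : ∀ x, e (P.col x) ∈ V := fun x =>
    Submodule.mem_map_of_mem (Submodule.subset_span ⟨x, rfl⟩)
  let b : OrthonormalBasis (Fin d) ℝ V := (stdOrthonormalBasis ℝ V).reindex (finCongr hV)
  refine ⟨fun x => b.repr ⟨e (P.col x), hmem x⟩, fun x y => ?_⟩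
  rw [LinearIsometryEquiv.inner_map_map, Submodule.coe_inner]
  conv_rhs => rw [← hidem, Matrix.mul_apply]
  rw [PiLp.inner_apply]
  refine Finset.sum_congr rfl fun z _ => ?_
  simp only [RCLike.inner_apply, conj_trivial]
  change P z y * P z x = _
  rw [hsymm z x, mul_comm]

/-- At least `2d` unit vectors of `ℝ^d` any two of which are orthogonal or equal up to sign
consist, up to sign, of an orthonormal basis. -/
theorem exists_orthonormalBasis_of_two_mul_le_card {d : ℕ}
    (V : Finset (EuclideanSpace ℝ (Fin d))) (hcard : 2 * d ≤ V.card) (hunit : ∀ v ∈ V, ‖v‖ = 1)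
    (horth : ∀ v ∈ V, ∀ w ∈ V, inner ℝ v w = 0 ∨ v = w ∨ v = -w) :
    ∃ b : OrthonormalBasis (Fin d) ℝ (EuclideanSpace ℝ (Fin d)),
      (∀ i, b i ∈ V) ∧ ∀ v ∈ V, ∃ i, v = b i ∨ v = -b i := by
  classical
  -- A largest orthogonal subset `T` meets every pair ±v, so `V` has at most 2|T| elements; as |T| ≤
  -- d, the lower bound on |V| forces |T| = d.
  obtain ⟨T, hT, hmax⟩ := Finset.exists_max_image
    (V.powerset.filter fun T => ∀ v ∈ T, ∀ w ∈ T, v ≠ w → inner ℝ v w = 0) Finset.card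
    ⟨∅, by simp⟩
  rw [Finset.mem_filter, Finset.mem_powerset] at hT
  obtain ⟨hTV, hTorth⟩ := hT
  have hcover : ∀ v ∈ V, ∃ t ∈ T, v = t ∨ v = -t := by
    intro v hv
    by_contra hno
    push Not at hno
    have hvT : v ∉ T := fun h => (hno v h).1 rfl
    have hvt : ∀ t ∈ T, inner ℝ v t = 0 := fun t ht =>
      (horth v hv t (hTV ht)).resolve_right (by rw [not_or]; exact hno t ht)
    have hle := hmax (insert v T) (by
      rw [Finset.mem_filter, Finset.mem_powerset]
      refine ⟨Finset.insert_subset hv hTV, ?_⟩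
      intro x hx y hy hxy
      rcases Finset.mem_insert.mp hx with hx' | hx' <;>
        rcases Finset.mem_insert.mp hy with hy' | hy'
      · exact absurd (hx'.trans hy'.symm) hxy
      · rw [hx']; exact hvt y hy'
      · rw [hy', real_inner_comm]; exact hvt x hx'
      · exact hTorth x hx' y hy' hxy)
    rw [Finset.card_insert_of_notMem hvT] at hle
    omega
  have hle : V.card ≤ 2 * T.card := by
    have hsub : V ⊆ T ∪ T.image fun t => -t := by
      intro v hv
      obtain ⟨t, ht, h | h⟩ := hcover v hv
      · exact Finset.mem_union_left _ (h ▸ ht)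
      · exact Finset.mem_union_right _ (Finset.mem_image.mpr ⟨t, ht, h.symm⟩)
    have h1 := Finset.card_le_card hsub
    have h2 := Finset.card_union_le T (T.image fun t => -t)
    have h3 : (T.image fun t => -t).card ≤ T.card := Finset.card_image_le
    omega
  have hon : Orthonormal ℝ (fun t : T => (t : EuclideanSpace ℝ (Fin d))) :=
    ⟨fun t => hunit _ (hTV t.2), fun s t hst => hTorth _ s.2 _ t.2 fun h => hst (Subtype.ext h)⟩
  have hTd : T.card = d := by
    have h := hon.linearIndependent.fintype_card_le_finrank
    rw [finrank_euclideanSpace_fin, Fintype.card_coe] at h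
    omega
  let g : Fin d ≃ T := (T.equivFinOfCardEq hTd).symm
  obtain ⟨b, hb⟩ := Orthonormal.exists_orthonormalBasis_extension_of_card_eq (𝕜 := ℝ)
    (E := EuclideanSpace ℝ (Fin d)) (ι := Fin d) (by simp)
    (v := fun i => (g i : EuclideanSpace ℝ (Fin d))) (s := Set.univ)
    (hon.comp (fun i : (Set.univ : Set (Fin d)) => g i) fun i j h =>
      Subtype.ext (g.injective h))
  have hb' : ∀ i, b i = g i := fun i => hb i (Set.mem_univ i)
  refine ⟨b, fun i => by rw [hb']; exact hTV (g i).2, fun v hv => ?_⟩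
  obtain ⟨t, ht, h⟩ := hcover v hv
  refine ⟨g.symm ⟨t, ht⟩, ?_⟩
  rw [hb', g.apply_symm_apply]
  exact h

/-! ### Angles, antipodal classes and their sizes -/

namespace DualRecurrence

variable {X : Type*} [Fintype X] {E : Fin 5 → Matrix X X ℝ} {d : ℕ} {c : ℝ}

theorem two_le (h : DualRecurrence E d c) : 2 ≤ d := by
  have h0 : d ≠ 0 := by exact_mod_cast h.d_ne_zero
  have h1 : d ≠ 1 := by exact_mod_cast h.d_ne_one
  omega

theorem cases (h : DualRecurrence E d c) (x y : X) :
    (Fintype.card X * E 1 x y = 0 ∧ Fintype.card X * E 2 x y = -(d / c) ∧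
      Fintype.card X * E 4 x y = d / c - 1) ∨
    ((Fintype.card X * E 1 x y) ^ 2 = d ∧ Fintype.card X * E 2 x y = 0 ∧
      Fintype.card X * E 4 x y = -1) ∨
    ((Fintype.card X * E 1 x y) ^ 2 = (d : ℝ) ^ 2 ∧
      Fintype.card X * E 2 x y = (d - 1) * (d / c) ∧ Fintype.card X * E 4 x y = d / c - 1) :=
  dual_recurrence_cases h.c_ne_zero h.d_ne_zero h.d_ne_one (h.one x y) (h.two x y) (h.three x y)
    (h.four x y)

/-- The entry of `E 1` determines the entries of all the `E j`. -/
theorem apply_eq_of_apply_one_eq (h : DualRecurrence E d c) (hN : (Fintype.card X : ℝ) ≠ 0)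
    {x y x' y' : X} (h1 : E 1 x y = E 1 x' y') (j : Fin 5) : E j x y = E j x' y' := by
  have hd2 : (2 : ℝ) ≤ d := by exact_mod_cast h.two_le
  apply mul_left_cancel₀ hN
  -- The three cases have squares 0, d and d², which are distinct for d ≥ 2, so the entry of `E 1`
  -- tells which case holds.
  have key : Fintype.card X * E 2 x y = Fintype.card X * E 2 x' y' ∧
      Fintype.card X * E 4 x y = Fintype.card X * E 4 x' y' := by
    have ha := h.cases x y
    have hb := h.cases x' y'
    rw [h1] at ha
    rcases ha with ⟨u, v, w⟩ | ⟨u, v, w⟩ | ⟨u, v, w⟩ <;>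
      rcases hb with ⟨u', v', w'⟩ | ⟨u', v', w'⟩ | ⟨u', v', w'⟩ <;>
      first
        | exact ⟨v.trans v'.symm, w.trans w'.symm⟩
        | (exfalso; simp only [u] at u'; nlinarith)
        | (exfalso; simp only [u'] at u; nlinarith)
  fin_cases j
  · exact (h.zero x y).trans (h.zero x' y').symm
  · exact congrArg _ h1
  · exact key.1
  · change _ * E 3 x y = _ * E 3 x' y'
    rw [← h.four x y, ← h.four x' y', h1, key.2]
  · exact key.2

/-- The angles of the vectors represented by `E 1`. -/
theorem exists_angle (h : DualRecurrence E d c) (x y : X) :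
    ∃ k, Fintype.card X / d * E 1 x y = mubAngle d k := by
  have hd0 := h.d_ne_zero
  have hd2 : (2 : ℝ) ≤ d := by exact_mod_cast h.two_le
  have hsq : √(d : ℝ) * √(d : ℝ) = d := Real.mul_self_sqrt (by linarith)
  have hs0 : √(d : ℝ) ≠ 0 := fun e => by rw [e] at hsq; linarith
  have hform : Fintype.card X / d * E 1 x y = (Fintype.card X * E 1 x y) / d := by ring
  have hsd : 1 / √(d : ℝ) = √(d : ℝ) / d := by
    rw [div_eq_div_iff hs0 hd0, hsq, one_mul]
  rw [hform]
  rcases h.cases x y with ⟨u, -⟩ | ⟨u, -⟩ | ⟨u, -⟩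
  · exact ⟨2, by rw [u, zero_div]; rfl⟩
  · have : (Fintype.card X * E 1 x y - √(d : ℝ)) * (Fintype.card X * E 1 x y + √(d : ℝ)) = 0 := by
      linear_combination u - hsq
    rcases mul_eq_zero.mp this with e | e
    · exact ⟨1, by rw [sub_eq_zero.mp e, ← hsd]; rfl⟩
    · exact ⟨3, by rw [eq_neg_of_add_eq_zero_left e, neg_div, ← hsd]; rfl⟩
  · rcases sq_eq_sq_iff_eq_or_eq_neg.mp u with e | e
    · exact ⟨0, by rw [e, div_self hd0]; rfl⟩
    · exact ⟨4, by rw [e, neg_div, div_self hd0]; rfl⟩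

theorem mem_qAntipodalClass_iff (h : DualRecurrence E d c) (hN : (Fintype.card X : ℝ) ≠ 0)
    {x y : X} : y ∈ qAntipodalClass E x ↔ Fintype.card X * E 4 x y = d / c - 1 := by
  have hF : (d : ℝ) / c ≠ 0 := div_ne_zero h.d_ne_zero h.c_ne_zero
  have hz := h.zero x y
  have : y ∈ qAntipodalClass E x ↔ Fintype.card X * E 0 x y + Fintype.card X * E 4 x y ≠ 0 := by
    rw [← mul_add, mul_ne_zero_iff]
    exact ⟨fun hy => ⟨hN, hy⟩, fun hy => hy.2⟩
  rw [this, hz]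
  rcases h.cases x y with ⟨-, -, w⟩ | ⟨-, -, w⟩ | ⟨-, -, w⟩ <;> rw [w]
  · simpa using hF
  · simp only [add_neg_cancel, ne_eq, not_true, false_iff]
    intro e
    exact hF (by linarith)
  · simpa using hF

open Classical in
theorem card_mul_add_apply (h : DualRecurrence E d c) (hN : (Fintype.card X : ℝ) ≠ 0) (x y : X) :
    Fintype.card X * (E 0 + E 4) x y =
      (d / c) * if y ∈ qAntipodalClass E x then 1 else 0 := by
  rw [Matrix.add_apply, mul_add, h.zero]
  split_ifs with hy
  · rw [(h.mem_qAntipodalClass_iff hN).mp hy]; ring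
  · rw [h.mem_qAntipodalClass_iff hN] at hy
    rcases h.cases x y with ⟨-, -, w⟩ | ⟨-, -, w⟩ | ⟨-, -, w⟩
    · exact absurd w hy
    · rw [w]; ring
    · exact absurd w hy

variable [DecidableEq X] {R : Fin 5 → X → X → Prop}

theorem card_mul_diag_one (hR : IsSymmetricAssociationScheme R)
    (hE : IsPrimitiveIdempotentOrdering R E) (hd : (E 1).rank = d) (x : X) :
    Fintype.card X * E 1 x x = d := by
  rw [hE.card_mul_diag hR, ← Matrix.rank_eq_trace_of_idempotent (hE.idem 1), hd]

theorem diag_four (h : DualRecurrence E d c) (hR : IsSymmetricAssociationScheme R)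
    (hE : IsPrimitiveIdempotentOrdering R E) (hd : (E 1).rank = d) (x : X) :
    Fintype.card X * E 2 x x = (d - 1) * (d / c) ∧ Fintype.card X * E 4 x x = d / c - 1 := by
  have hd2 : (2 : ℝ) ≤ d := by exact_mod_cast h.two_le
  have hu := card_mul_diag_one hR hE hd x
  rcases h.cases x x with ⟨u, v, w⟩ | ⟨u, v, w⟩ | ⟨u, v, w⟩
  · rw [hu] at u; linarith
  · rw [hu] at u; nlinarith
  · exact ⟨v, w⟩

/-- Compare diagonal entries in the sum of all `E j`: |X| = 1 + d + (d - 1)d/c + d(d/c - 1) + (d/c -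
1). -/
theorem card_eq (h : DualRecurrence E d c) (hR : IsSymmetricAssociationScheme R)
    (hE : IsPrimitiveIdempotentOrdering R E) (hd : (E 1).rank = d) :
    (Fintype.card X : ℝ) = 2 * d * (d / c) := by
  obtain ⟨x, -⟩ := hR.rel_nonempty 0
  have hu := card_mul_diag_one hR hE hd x
  obtain ⟨v, w⟩ := h.diag_four hR hE hd x
  have h3 := h.four x x
  rw [hu, w] at h3
  have hsum := congrFun (congrFun hE.sum_eq_one x) x
  rw [Matrix.sum_apply, Fin.sum_univ_five, Matrix.one_apply_eq] at hsum
  have h0 := h.zero x x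
  linear_combination (-(Fintype.card X : ℝ)) * hsum + h0 + hu + v - h3 + w

theorem eq_of_apply_one (h : DualRecurrence E d c) (hR : IsSymmetricAssociationScheme R)
    (hE : IsPrimitiveIdempotentOrdering R E) {x y : X} (hxy : E 1 x y = E 1 x x) : x = y := by
  have hall := h.apply_eq_of_apply_one_eq hR.card_ne_zero hxy
  have := hE.rel_of_apply_eq (fun i => (hall i).symm) ((hR.rel_zero_iff x x).mpr rfl)
  exact (hR.rel_zero_iff x y).mp this

-- `E 0 + E 4` is idempotent and is d/(c|X|) times the 0-1 matrix of class membership, where |X| =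
-- 2d · d/c. This identity gives both the transitivity of membership and, on the diagonal, the class
-- size.
open Classical in
theorem sum_class (h : DualRecurrence E d c) (hR : IsSymmetricAssociationScheme R)
    (hE : IsPrimitiveIdempotentOrdering R E) (hd : (E 1).rank = d) (x y : X) :
    (∑ z, (if z ∈ qAntipodalClass E x then (1 : ℝ) else 0) *
      (if y ∈ qAntipodalClass E z then 1 else 0)) =
      2 * d * if y ∈ qAntipodalClass E x then 1 else 0 := by
  have hN := hR.card_ne_zero
  have hF : (d : ℝ) / c ≠ 0 := div_ne_zero h.d_ne_zero h.c_ne_zero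
  have hidem : (E 0 + E 4) * (E 0 + E 4) = E 0 + E 4 := by
    rw [mul_add, add_mul, add_mul, hE.idem, hE.idem, hE.orth 0 4 (by decide),
      hE.orth 4 0 (by decide), add_zero, zero_add]
  have hxy := congrFun (congrFun hidem x) y
  rw [Matrix.mul_apply] at hxy
  have h1 : (Fintype.card X : ℝ) * (Fintype.card X * ∑ z, (E 0 + E 4) x z * (E 0 + E 4) z y) =
      ∑ z, (Fintype.card X * (E 0 + E 4) x z) * (Fintype.card X * (E 0 + E 4) z y) := by
    rw [Finset.mul_sum, Finset.mul_sum]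
    exact Finset.sum_congr rfl fun z _ => by ring
  rw [hxy] at h1
  simp only [h.card_mul_add_apply hN] at h1
  rw [h.card_eq hR hE hd] at h1
  have h2 : ∑ z, (d / c * if z ∈ qAntipodalClass E x then (1 : ℝ) else 0) *
      (d / c * if y ∈ qAntipodalClass E z then 1 else 0) =
      (d / c) * (d / c) * ∑ z, (if z ∈ qAntipodalClass E x then (1 : ℝ) else 0) *
      (if y ∈ qAntipodalClass E z then 1 else 0) := by
    rw [Finset.mul_sum]
    exact Finset.sum_congr rfl fun z _ => by ring
  rw [h2] at h1
  apply mul_left_cancel₀ (mul_ne_zero hF hF)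
  rw [← h1]
  ring

theorem mem_self (h : DualRecurrence E d c) (hR : IsSymmetricAssociationScheme R)
    (hE : IsPrimitiveIdempotentOrdering R E) (hd : (E 1).rank = d) (x : X) :
    x ∈ qAntipodalClass E x :=
  (h.mem_qAntipodalClass_iff hR.card_ne_zero).mpr (h.diag_four hR hE hd x).2

theorem mem_comm (hR : IsSymmetricAssociationScheme R)
    (hE : IsPrimitiveIdempotentOrdering R E) {x y : X} :
    x ∈ qAntipodalClass E y ↔ y ∈ qAntipodalClass E x := by
  simp only [qAntipodalClass, Set.mem_ofPred_eq, Matrix.add_apply, hE.apply_comm hR _ x y]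

theorem mem_trans (h : DualRecurrence E d c) (hR : IsSymmetricAssociationScheme R)
    (hE : IsPrimitiveIdempotentOrdering R E) (hd : (E 1).rank = d) {x y z : X}
    (hz : z ∈ qAntipodalClass E x) (hy : y ∈ qAntipodalClass E z) : y ∈ qAntipodalClass E x := by
  classical
  -- Otherwise the sum of nonnegative terms in `sum_class` would be 0, although the term at `z` is
  -- 1.
  by_contra hno
  have hs := h.sum_class hR hE hd x y
  rw [if_neg hno, mul_zero, Finset.sum_eq_zero_iff_of_nonneg] at hs
  · have := hs z (Finset.mem_univ z)
    simp [hz, hy] at this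
  · intro w _
    positivity

theorem class_eq_iff (h : DualRecurrence E d c) (hR : IsSymmetricAssociationScheme R)
    (hE : IsPrimitiveIdempotentOrdering R E) (hd : (E 1).rank = d) {x y : X} :
    qAntipodalClass E x = qAntipodalClass E y ↔ x ∈ qAntipodalClass E y := by
  constructor
  · intro e
    rw [← e]
    exact h.mem_self hR hE hd x
  · intro hx
    ext z
    exact ⟨fun hz => h.mem_trans hR hE hd hx hz,
      fun hz => h.mem_trans hR hE hd ((mem_comm hR hE).mp hx) hz⟩

theorem ncard_class (h : DualRecurrence E d c) (hR : IsSymmetricAssociationScheme R)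
    (hE : IsPrimitiveIdempotentOrdering R E) (hd : (E 1).rank = d) (x : X) :
    (qAntipodalClass E x).ncard = 2 * d := by
  classical
  have hs := h.sum_class hR hE hd x x
  simp only [mem_comm hR hE (x := x), if_pos (h.mem_self hR hE hd x), mul_one] at hs
  have : ((qAntipodalClass E x).ncard : ℝ) = 2 * d := by
    rw [← hs, Set.ncard_eq_toFinset_card', Set.toFinset_card, Fintype.card_subtype,
      Finset.card_filter]
    push_cast
    exact Finset.sum_congr rfl fun z _ => by split_ifs <;> simp
  exact_mod_cast this

/-- Classes of size 2d partition a set of 2d · d/c points. -/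
theorem num_classes (h : DualRecurrence E d c) (hR : IsSymmetricAssociationScheme R)
    (hE : IsPrimitiveIdempotentOrdering R E) (hd : (E 1).rank = d) :
    (numQAntipodalClasses E : ℝ) = d / c := by
  classical
  have hcard : Fintype.card X = numQAntipodalClasses E * (2 * d) := by
    have hT : numQAntipodalClasses E = (Finset.univ.image (qAntipodalClass E)).card := by
      rw [numQAntipodalClasses, ← Set.ncard_coe_finset]
      simp
    rw [hT, ← Finset.card_univ,
      Finset.card_eq_sum_card_image (qAntipodalClass E) Finset.univ]
    apply Finset.sum_const_nat
    intro S hS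
    obtain ⟨x, -, rfl⟩ := Finset.mem_image.mp hS
    rw [← h.ncard_class hR hE hd x, Set.ncard_eq_toFinset_card']
    congr 1
    ext y
    simp [h.class_eq_iff hR hE hd]
  have h1 := h.card_eq hR hE hd
  rw [hcard] at h1
  push_cast at h1
  have hd0 := h.d_ne_zero
  apply mul_left_cancel₀ (mul_ne_zero two_ne_zero hd0)
  linarith

theorem two_le_num_classes (h : DualRecurrence E d c) (hR : IsSymmetricAssociationScheme R)
    (hE : IsPrimitiveIdempotentOrdering R E) (hd : (E 1).rank = d) :
    2 ≤ numQAntipodalClasses E := by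
  have hF := h.num_classes hR hE hd
  have h0 : numQAntipodalClasses E ≠ 0 := by
    intro e
    rw [e, Nat.cast_zero] at hF
    exact div_ne_zero h.d_ne_zero h.c_ne_zero hF.symm
  have h1 : numQAntipodalClasses E ≠ 1 := by
    intro e
    rw [e, Nat.cast_one, eq_div_iff h.c_ne_zero, one_mul] at hF
    exact h.d_ne_c hF.symm
  omega

/-- The relations are distinguished by the angles, which all occur. -/
theorem exists_perm (h : DualRecurrence E d c) (hR : IsSymmetricAssociationScheme R)
    (hE : IsPrimitiveIdempotentOrdering R E) :
    ∃ σ : Equiv.Perm (Fin 5), ∀ k x y,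
      R k x y ↔ Fintype.card X / d * E 1 x y = mubAngle d (σ k) := by
  have hN := hR.card_ne_zero
  have hinj := mubAngle_injective h.two_le
  choose a b hab using hR.rel_nonempty
  choose τ hτ using fun k => h.exists_angle (a k) (b k)
  have hrel : ∀ k x y, R k x y → Fintype.card X / d * E 1 x y = mubAngle d (τ k) := by
    intro k x y hk
    rw [← hτ k, boseMesner_apply_eq hR.rel_partition (hE.mem_boseMesner 1) hk (hab k)]
  -- Equal angles mean equal entries of `E 1`, hence of all `E j`, hence the same relation. An
  -- injection of the five relations into the five angles is a permutation, so every angle occurs.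
  have hτinj : Function.Injective τ := by
    intro k l hkl
    have h1 : E 1 (a k) (b k) = E 1 (a l) (b l) := by
      have := (hτ k).trans ((congrArg _ hkl).trans (hτ l).symm)
      exact mul_left_cancel₀ (div_ne_zero hN h.d_ne_zero) this
    have := hE.rel_of_apply_eq (h.apply_eq_of_apply_one_eq hN h1) (hab k)
    exact (hR.rel_partition _ _).unique this (hab l)
  refine ⟨Equiv.ofBijective τ (Finite.injective_iff_bijective.mp hτinj), fun k x y =>
    ⟨hrel k x y, fun e => ?_⟩⟩
  obtain ⟨l, hl, -⟩ := hR.rel_partition x y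
  have : τ l = τ k := hinj ((hrel l x y hl).symm.trans e)
  rw [← hτinj this]
  exact hl

end DualRecurrence

/-! ### The representation by MUB and the conclusion -/

/-- Every point of an association scheme has a neighbour in each relation. -/
theorem IsSymmetricAssociationScheme.exists_rel {X : Type*} [Fintype X] {n : ℕ}
    {R : Fin (n + 1) → X → X → Prop} (hR : IsSymmetricAssociationScheme R) (k : Fin (n + 1))
    (x : X) : ∃ y, R k x y := by
  obtain ⟨p, hp⟩ := hR.intersection_number k k 0
  obtain ⟨a, b, hab⟩ := hR.rel_nonempty k
  have ha := hp a a ((hR.rel_zero_iff a a).mpr rfl)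
  have hx := hp x x ((hR.rel_zero_iff x x).mpr rfl)
  have hpos : 0 < {z | R k a z ∧ R k z a}.ncard :=
    (Set.ncard_pos (Set.toFinite _)).mpr ⟨b, hab, hR.rel_symm k a b hab⟩
  rw [ha, ← hx, Set.ncard_pos (Set.toFinite _)] at hpos
  obtain ⟨y, hy, -⟩ := hpos
  exact ⟨y, hy⟩

/-- The representation of a scheme satisfying the dual recurrences by mutually unbiased bases. -/
theorem DualRecurrence.exists_mub {X : Type*} [Fintype X] [DecidableEq X]
    {R : Fin 5 → X → X → Prop} {E : Fin 5 → Matrix X X ℝ} {d : ℕ} {c : ℝ}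
    (h : DualRecurrence E d c) (hR : IsSymmetricAssociationScheme R)
    (hE : IsPrimitiveIdempotentOrdering R E) (hd : (E 1).rank = d) :
    ∃ (M : Fin (numQAntipodalClasses E) →
        OrthonormalBasis (Fin d) ℝ (EuclideanSpace ℝ (Fin d)))
      (φ : X ≃ mubPoints M) (σ : Equiv.Perm (Fin 5)),
      IsMUB M ∧
      (∀ x y, inner ℝ (φ x : EuclideanSpace ℝ (Fin d)) (φ y : EuclideanSpace ℝ (Fin d)) =
        (Fintype.card X : ℝ) / d * E 1 x y) ∧
      ∀ k x y, R k x y ↔ mubRel M (σ k) (φ x) (φ y) := by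
  classical
  have hN := hR.card_ne_zero
  have hd0 := h.d_ne_zero
  have hd2 : (2 : ℝ) ≤ d := by exact_mod_cast h.two_le
  obtain ⟨σ, hσ⟩ := h.exists_perm hR hE
  obtain ⟨ψ₀, hψ₀⟩ := Matrix.exists_gram_of_idempotent (hE.apply_comm hR 1) (hE.idem 1) hd
  -- The diagonal entries of `E 1` are d/|X|, so this scaling makes the vectors unit vectors.
  let ψ : X → EuclideanSpace ℝ (Fin d) := fun x => √((Fintype.card X : ℝ) / d) • ψ₀ x
  have hψ : ∀ x y, inner ℝ (ψ x) (ψ y) = (Fintype.card X : ℝ) / d * E 1 x y := by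
    intro x y
    rw [real_inner_smul_left, real_inner_smul_right, hψ₀, ← mul_assoc,
      Real.mul_self_sqrt (by positivity)]
  have hform : ∀ x y, (Fintype.card X : ℝ) / d * E 1 x y = (Fintype.card X * E 1 x y) / d :=
    fun x y => by ring
  have hself : ∀ x, inner ℝ (ψ x) (ψ x) = 1 := fun x => by
    rw [hψ, hform, card_mul_diag_one hR hE hd, div_self hd0]
  have hnorm : ∀ x, ‖ψ x‖ = 1 := fun x => by
    have := hself x
    rw [real_inner_self_eq_norm_sq] at this
    nlinarith [norm_nonneg (ψ x)]
  have hinj : Function.Injective ψ := by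
    intro x y hxy
    have h1 : inner ℝ (ψ x) (ψ y) = inner ℝ (ψ x) (ψ x) := by rw [hxy]
    rw [hψ, hψ] at h1
    exact h.eq_of_apply_one hR hE (mul_left_cancel₀ (div_ne_zero hN hd0) h1)
  have hsame : ∀ {x y}, y ∈ qAntipodalClass E x →
      inner ℝ (ψ x) (ψ y) = 0 ∨ ψ x = ψ y ∨ ψ x = -ψ y := by
    intro x y hy
    rw [h.mem_qAntipodalClass_iff hN] at hy
    rcases h.cases x y with ⟨u, -⟩ | ⟨-, -, w⟩ | ⟨u, -⟩
    · left; rw [hψ, hform, u, zero_div]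
    · rw [hy] at w
      exact absurd (by linarith : (d : ℝ) / c = 0) (div_ne_zero hd0 h.c_ne_zero)
    · right
      rcases sq_eq_sq_iff_eq_or_eq_neg.mp u with e | e
      · left
        rw [← inner_eq_one_iff_of_norm_eq_one (𝕜 := ℝ) (hnorm x) (hnorm y), hψ, hform, e,
          div_self hd0]
      · right
        rw [← inner_eq_one_iff_of_norm_eq_one (𝕜 := ℝ) (hnorm x) (by rw [norm_neg, hnorm y]),
          inner_neg_right, hψ, hform, e, neg_div, div_self hd0, neg_neg]
  have hdiff : ∀ {x y}, y ∉ qAntipodalClass E x → inner ℝ (ψ x) (ψ y) = 1 / √(d : ℝ) ∨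
      inner ℝ (ψ x) (ψ y) = -(1 / √(d : ℝ)) := by
    intro x y hy
    rw [h.mem_qAntipodalClass_iff hN] at hy
    rcases h.cases x y with ⟨-, -, w⟩ | ⟨u, -⟩ | ⟨-, -, w⟩
    · exact absurd w hy
    · apply sq_eq_sq_iff_eq_or_eq_neg.mp
      rw [hψ, hform, inv_sqrt_sq, div_pow, u]
      field_simp
    · exact absurd w hy
  -- The angle -1 belongs to some relation, in which every point has a neighbour. The image is
  -- therefore closed under negation, which makes `φ` surjective.
  have hneg : ∀ x, ∃ y, ψ y = -ψ x := by
    intro x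
    obtain ⟨y, hy⟩ := hR.exists_rel (σ.symm 4) x
    refine ⟨y, ?_⟩
    rw [hσ, ← hψ, σ.apply_symm_apply] at hy
    have hy' : inner ℝ (ψ x) (ψ y) = -1 := hy
    rw [← inner_eq_one_iff_of_norm_eq_one (𝕜 := ℝ) (hnorm y) (by rw [norm_neg, hnorm x]),
      inner_neg_right, real_inner_comm, hy', neg_neg]
  have hbasis : ∀ x₀, ∃ b : OrthonormalBasis (Fin d) ℝ (EuclideanSpace ℝ (Fin d)),
      (∀ i, ∃ x ∈ qAntipodalClass E x₀, b i = ψ x) ∧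
      ∀ x ∈ qAntipodalClass E x₀, ∃ i, ψ x = b i ∨ ψ x = -b i := by
    intro x₀
    obtain ⟨b, hb, hb'⟩ := exists_orthonormalBasis_of_two_mul_le_card
      ((qAntipodalClass E x₀).toFinset.image ψ)
      (by
        rw [Finset.card_image_of_injective _ hinj, ← Set.ncard_eq_toFinset_card',
          h.ncard_class hR hE hd])
      (by
        intro v hv
        obtain ⟨x, -, rfl⟩ := Finset.mem_image.mp hv
        exact hnorm x)
      (by
        intro v hv w hw
        obtain ⟨x, hx, rfl⟩ := Finset.mem_image.mp hv
        obtain ⟨y, hy, rfl⟩ := Finset.mem_image.mp hw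
        rw [Set.mem_toFinset] at hx hy
        exact hsame (h.mem_trans hR hE hd ((mem_comm hR hE).mp hx) hy))
    refine ⟨b, fun i => ?_, fun x hx => hb' _ (Finset.mem_image_of_mem _ (by simpa using hx))⟩
    obtain ⟨x, hx, hxi⟩ := Finset.mem_image.mp (hb i)
    exact ⟨x, by simpa using hx, hxi.symm⟩
  choose B hB₁ hB₂ using hbasis
  let ε : Fin (numQAntipodalClasses E) ≃ Set.range (qAntipodalClass E) :=
    (Finite.equivFinOfCardEq rfl).symm
  choose r hr using fun a => (ε a).2
  have hr_inj : ∀ a b, r b ∈ qAntipodalClass E (r a) → a = b := by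
    intro a b hab
    rw [← h.class_eq_iff hR hE hd, hr, hr] at hab
    exact (ε.injective (Subtype.ext hab)).symm
  have hr_surj : ∀ x, ∃ a, x ∈ qAntipodalClass E (r a) := by
    intro x
    refine ⟨ε.symm ⟨_, x, rfl⟩, ?_⟩
    rw [hr, ε.apply_symm_apply]
    exact h.mem_self hR hE hd x
  let M : Fin (numQAntipodalClasses E) → OrthonormalBasis (Fin d) ℝ (EuclideanSpace ℝ (Fin d)) :=
    fun a => B (r a)
  have hmem : ∀ x, ψ x ∈ mubPoints M := fun x => by
    obtain ⟨a, ha⟩ := hr_surj x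
    obtain ⟨i, hi⟩ := hB₂ (r a) x ha
    exact ⟨a, i, hi⟩
  have hbij : Function.Bijective fun x => (⟨ψ x, hmem x⟩ : mubPoints M) := by
    refine ⟨fun x y hxy => hinj (congrArg Subtype.val hxy), ?_⟩
    rintro ⟨v, a, i, hv⟩
    obtain ⟨x, -, hx⟩ := hB₁ (r a) i
    rcases hv with hv | hv
    · exact ⟨x, Subtype.ext (hx.symm.trans hv.symm)⟩
    · obtain ⟨y, hy⟩ := hneg x
      exact ⟨y, Subtype.ext (hy.trans ((congrArg _ hx.symm).trans hv.symm))⟩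
  refine ⟨M, Equiv.ofBijective _ hbij, σ, ?_, hψ, fun k x y => ?_⟩
  · intro a b hab i j
    obtain ⟨x, hx, hxi⟩ := hB₁ (r a) i
    obtain ⟨y, hy, hyj⟩ := hB₁ (r b) j
    change inner ℝ (B (r a) i) (B (r b) j) = _ ∨ inner ℝ (B (r a) i) (B (r b) j) = _
    rw [hxi, hyj]
    apply hdiff
    intro hxy
    exact hab (hr_inj a b (h.mem_trans hR hE hd (h.mem_trans hR hE hd hx hxy)
      ((mem_comm hR hE).mp hy)))
  · rw [hσ, ← hψ]
    rfl

theorem theorem4p2 :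
    (∀ (X : Type*) [Fintype X] [DecidableEq X] (R : Fin 5 → X → X → Prop)
      (E : Fin 5 → Matrix X X ℝ) (d f : ℕ),
      IsSymmetricAssociationScheme R → IsPrimitiveIdempotentOrdering R E →
      IsQPolynomial E → IsQAntipodal E → IsQBipartite E →
      (E 1).rank = d → numQAntipodalClasses E = f →
      (IsQuadruplyRegular R ↔ (f : ℝ) = (d : ℝ) / 2 + 1) ∧
      (∀ x, (qAntipodalClass E x).ncard = 2 * d) ∧
      ∃ (M : Fin f → OrthonormalBasis (Fin d) ℝ (EuclideanSpace ℝ (Fin d)))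
        (φ : X ≃ mubPoints M) (σ : Equiv.Perm (Fin 5)),
        IsMUB M ∧
        (∀ x y, inner ℝ (φ x : EuclideanSpace ℝ (Fin d)) (φ y : EuclideanSpace ℝ (Fin d)) =
          (Fintype.card X : ℝ) / d * E 1 x y) ∧
        ∀ k x y, R k x y ↔ mubRel M (σ k) (φ x) (φ y)) ∧
    (∀ (d f : ℕ) (M : Fin f → OrthonormalBasis (Fin d) ℝ (EuclideanSpace ℝ (Fin d))),
      2 ≤ d → 2 ≤ f → IsMUB M →
      IsSymmetricAssociationScheme (mubRel M) ∧
      (∃ E : Fin 5 → Matrix (mubPoints M) (mubPoints M) ℝ,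
        IsPrimitiveIdempotentOrdering (mubRel M) E ∧
        IsQPolynomial E ∧ IsQAntipodal E ∧ IsQBipartite E ∧
        (E 1).rank = d ∧ numQAntipodalClasses E = f) ∧
      (IsQuadruplyRegular (mubRel M) ↔ (f : ℝ) = (d : ℝ) / 2 + 1)) := by
  refine ⟨?_, ?_⟩
  · intro X _ _ R E d f hR hE hQ hA hB hd hf
    subst hf
    obtain ⟨c, hrec⟩ := exists_dualRecurrence hR hE hQ hA hB
    rw [hd] at hrec
    obtain ⟨M, φ, σ, hM, hinner, hrel⟩ := hrec.exists_mub hR hE hd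
    refine ⟨?_, hrec.ncard_class hR hE hd, M, φ, σ, hM, hinner, hrel⟩
    rw [isQuadruplyRegular_iff_of_equiv φ σ hrel]
    exact isQuadruplyRegular_mubRel_iff_card_bases hrec.two_le
      (hrec.two_le_num_classes hR hE hd) hM
  · intro d f M hd hf hM
    exact ⟨mubRel_isSymmetricAssociationScheme hd hf hM,
      ⟨mubIdempotent M, mubIdempotent_isPrimitiveIdempotentOrdering hd hf hM,
        mubIdempotent_isQPolynomial hd hf hM, mubIdempotent_isQAntipodal hd hf hM,
        mubIdempotent_isQBipartite hd hf hM, rank_mubIdempotent_one hd hf hM,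
        numQAntipodalClasses_mubIdempotent hd hM⟩,
      isQuadruplyRegular_mubRel_iff_card_bases hd hf hM⟩
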